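/- Base stations and eavesdroppers form independent homogeneous Poisson point processes $\Phi_B$, $\Phi_E$ on $\mathbb{R}^2$ with intensities $\lambda_B,\lambda_E>0$; the typical user is at the origin $o$. Each link is, independently of the others, line-of-sight (type $L$) with probability $C\in[0,1]$ if its length is at most $D>0$ and with probability $0$ otherwise, and non-line-of-sight (type $N$) in the remaining case. A link of type $j\in\{L,N\}$ and length $r$ has path loss $C_jr^{-\alpha_j}$ with $C_j>0$, $\alpha_L>0$, $\alpha_N>2$, and an independent small-scale channel gain distributed as $\mathrm{gamma}(N_j,1)$ (shape $N_j$, scale $1$), $N_j\ge 1$ an integer. Write $L(x,y)$ for the path loss of the link from $x$ to $y$, $h_{xo}$ for the channel gain from the base station $x$ to the user, and $g_{xz}$ for that from $x$ to the eavesdropper $z$. The user is served by $x^*=\arg\max_{x\in\Phi_B}L(x,o)$ with antenna gain $M_s>0$. For each eavesdropper an angle $\theta$ is drawn independently and uniformly from $[-180^\circ,180^\circ]$; the antenna gain towards it is $G_b(\theta)=M_s$ if $|\theta|\le\theta_b$ and $G_b(\theta)=m_s>0$ otherwise, where $0\le\theta_b\le 180$, so that the main lobe (gain $M_s$) has probability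 $\Pr_{G_b}(M_s)=\theta_b/180$ and the side lobe (gain $m_s$) has probability $\Pr_{G_b}(m_s)=(180-\theta_b)/180$. Sums over $V\in\{M_s,m_s\}$ below run over these two lobes. Let $$I_E=\sum_{z\in\Phi_E}G_b(\theta)L(x^*,z)g_{x^*z},\qquad \tau_c=\Pr\left(\frac{M_sL(x^*,o)h_{x^*o}}{I_E}\ge 1\right).$$ Let $A_j$ be the probability that the link from $x^*$ to $o$ is of type $j$, let $r_j$ have the conditional law of $\|x^*\|$ given that this link is of type $j$ (a term with $A_j=0$ is read as $0$), and let $q_L=C$, $q_N=1-C$. For $s>0$ put $$\Xi(s)=-s\Bigg(2\pi\lambda_E\sum_{j\in\{L,N\}}q_j\sum_{V\in\{M_s,m_s\}}\Pr\nolimits_{G_b}(V)\frac{(VC_j)^{2/\alpha_j}}{\alpha_j}\sum_{m=0}^{N_j-1}\frac{(D^{\alpha_j}/(VC_j))^{m+2/\alpha_j}}{(m+\frac{2}{\alpha_j})(s+D^{\alpha_j}/(VC_j))^{m+1}}\,{}_2F_1\Big(1,m+1;m+\tfrac{2}{\alpha_j}+1;\tfrac{D^{\alpha_j}/(VC_j)}{D^{\alpha_j}/(VC_j)+s}\Big)$$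 $$\qquad+2\pi\lambda_E\sum_{V\in\{M_s,m_s\}}\Pr\nolimits_{G_b}(V)\frac{(VC_N)^{2/\alpha_N}}{\alpha_N}\sum_{m=0}^{N_N-1}\frac{(D^{\alpha_N}/(VC_N))^{m+2/\alpha_N}}{(1-\frac{2}{\alpha_N})(s+D^{\alpha_N}/(VC_N))^{m+1}}\,{}_2F_1\Big(1,m+1;2-\tfrac{2}{\alpha_N};\tfrac{s}{s+D^{\alpha_N}/(VC_N)}\Big)\Bigg),$$ where ${}_2F_1$ is the Gauss hypergeometric function. Then $I_E<\infty$ almost surely; the Laplace transform of $I_E$ is $\mathbb{E}(e^{-sI_E})=\mathcal{L}_{I_E}(s):=\exp(\Xi(s))$ for all $s>0$; $\mathcal{L}_{I_E}$ is smooth on $(0,\infty)$; and $$\tau_c=\sum_{j\in\{L,N\}}\mathbb{E}_{r_j}\left[\sum_{m=0}^{N_j-1}\left(\frac{r_j^{\alpha_j}}{M_sC_j}\right)^m\frac{A_j}{\Gamma(m+1)}(-1)^m\mathcal{L}^{(m)}_{I_E}\left(\frac{r_j^{\alpha_j}}{M_sC_j}\right)\right],$$ where the expectations exist (the integrands are integrable).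 -/

import Mathlib

open MeasureTheory ProbabilityTheory Set Filter Topology
open scoped ENNReal NNReal

namespace MmWave

/-- The Euclidean plane in which base stations and eavesdroppers are located. -/
abbrev Plane : Type := EuclideanSpace ℝ (Fin 2)

/-- A link is either line-of-sight (`los`, written `L`) or non-line-of-sight (`nlos`, `N`). -/
inductive LinkType : Type
  | los
  | nlos
  deriving DecidableEq

instance : Fintype LinkType := ⟨{LinkType.los, LinkType.nlos}, fun j => by cases j <;> decide⟩

/-- The two sectors of the antenna pattern: main lobe and side lobe. -/
inductive Lobe : Type
  | main
  | side
  deriving DecidableEq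

instance : Fintype Lobe := ⟨{Lobe.main, Lobe.side}, fun V => by cases V <;> decide⟩

/-- The parameters of the network. -/
structure Params where
  /-- intensity `λ_B` of the base stations -/
  lamB : ℝ
  /-- intensity `λ_E` of the eavesdroppers -/
  lamE : ℝ
  /-- array gain `V` of each lobe: `M_s = gain main`, `m_s = gain side` -/
  gain : Lobe → ℝ
  /-- beam width `θ_b` of the main lobe, in degrees -/
  beam : ℝ
  /-- probability `C` that a link of length at most `D` is line-of-sight -/
  C : ℝ
  /-- radius `D` of the line-of-sight ball -/
  D : ℝ
  /-- path loss exponents `α_L`, `α_N` -/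
  alpha : LinkType → ℝ
  /-- path loss intercepts `C_L`, `C_N` -/
  coef : LinkType → ℝ
  /-- Nakagami parameters `N_L`, `N_N` -/
  shape : LinkType → ℕ
  lamB_pos : 0 < lamB
  lamE_pos : 0 < lamE
  gain_pos : ∀ V, 0 < gain V
  beam_nonneg : 0 ≤ beam
  beam_le : beam ≤ 180
  C_nonneg : 0 ≤ C
  C_le_one : C ≤ 1
  D_pos : 0 < D
  alpha_los_pos : 0 < alpha LinkType.los
  two_lt_alpha_nlos : 2 < alpha LinkType.nlos
  coef_pos : ∀ j, 0 < coef j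
  shape_pos : ∀ j, 0 < shape j

namespace Params

noncomputable section

/-- `q_L(r)`: the probability that a link of length `r` is line-of-sight. -/
def losProb (p : Params) (r : ℝ) : ℝ := if r ≤ p.D then p.C else 0

/-- The sectored antenna pattern `G_b(θ)`, with `θ` in degrees. -/
def pattern (p : Params) (θ : ℝ) : ℝ :=
  if |θ| ≤ p.beam then p.gain Lobe.main else p.gain Lobe.side

/-- The path loss `C_j r^{-α_j}` of a link of type `j` and length `r`. -/
def pathLoss (p : Params) (j : LinkType) (r : ℝ) : ℝ := p.coef j * r ^ (-p.alpha j)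

/-- The type of a link of length `r` whose blockage variable is `u`; when `u` is uniform on
`[0, 1]`, the link is line-of-sight with probability `q_L(r)`. -/
def linkType (p : Params) (u r : ℝ) : LinkType :=
  if u < p.losProb r then LinkType.los else LinkType.nlos

/-- `Pr_{G_b}(V)`: `θ_b / 180` for the main lobe, `(180 - θ_b) / 180` for the side lobe. -/
def lobeProb (p : Params) : Lobe → ℝ
  | Lobe.main => p.beam / 180
  | Lobe.side => (180 - p.beam) / 180

/-- `q_L = C` and `q_N = 1 - C`. -/
def q (p : Params) : LinkType → ℝ
  | LinkType.los => p.C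
  | LinkType.nlos => 1 - p.C

/-- The number `D^{α_j} / (V C_j)`. -/
def edge (p : Params) (j : LinkType) (V : Lobe) : ℝ :=
  p.D ^ p.alpha j / (p.gain V * p.coef j)

/-- The exponent `Ξ(s)`. -/
def Xi (p : Params) (s : ℝ) : ℝ :=
  -s * (2 * Real.pi * p.lamE * (∑ j : LinkType, p.q j *
          ∑ V : Lobe, p.lobeProb V * ((p.gain V * p.coef j) ^ (2 / p.alpha j) / p.alpha j) *
            ∑ m ∈ Finset.range (p.shape j),
              p.edge j V ^ ((m : ℝ) + 2 / p.alpha j) /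
                (((m : ℝ) + 2 / p.alpha j) * (s + p.edge j V) ^ (m + 1)) *
              ordinaryHypergeometric (1 : ℝ) ((m : ℝ) + 1) ((m : ℝ) + 2 / p.alpha j + 1)
                (p.edge j V / (p.edge j V + s)))
      + 2 * Real.pi * p.lamE *
          ∑ V : Lobe, p.lobeProb V *
            ((p.gain V * p.coef LinkType.nlos) ^ (2 / p.alpha LinkType.nlos) /
              p.alpha LinkType.nlos) *
            ∑ m ∈ Finset.range (p.shape LinkType.nlos),
              p.edge LinkType.nlos V ^ ((m : ℝ) + 2 / p.alpha LinkType.nlos) /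
                ((1 - 2 / p.alpha LinkType.nlos) * (s + p.edge LinkType.nlos V) ^ (m + 1)) *
              ordinaryHypergeometric (1 : ℝ) ((m : ℝ) + 1) (2 - 2 / p.alpha LinkType.nlos)
                (s / (s + p.edge LinkType.nlos V)))

/-- The closed form `exp (Ξ(s))` of the Laplace transform of the aggregate eavesdropper signal. -/
def expXi (p : Params) (s : ℝ) : ℝ := Real.exp (p.Xi s)

/-- The point `r^{α_j} / (M_s C_j)`. -/
def arg (p : Params) (j : LinkType) (r : ℝ) : ℝ :=
  r ^ p.alpha j / (p.gain Lobe.main * p.coef j)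

/-- The law of the random marks of a link: a blockage variable, uniform on `[0, 1]`, and
independently for each link type `j` a `gamma(N_j, 1)` variable, the small-scale channel gain that
the link has if its type is `j`. -/
def linkLaw (p : Params) : Measure (ℝ × (LinkType → ℝ)) :=
  (ProbabilityTheory.cond volume (Icc (0 : ℝ) 1)).prod (Measure.pi fun j => gammaMeasure (p.shape j) 1)

/-- The law of the random marks of a link towards an eavesdropper: an angle, uniform on
`[-180, 180]` degrees, and independently of it the marks of a link. -/
def eveLinkLaw (p : Params) : Measure (ℝ × (ℝ × (LinkType → ℝ))) :=
  (ProbabilityTheory.cond volume (Icc (-180 : ℝ) 180)).prod p.linkLaw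

end

end Params

noncomputable section

variable {Ω : Type*} [MeasurableSpace Ω]

/-- The number of points of the point process `{X 0, X 1, …}` in the set `A`. -/
def count (X : ℕ → Ω → Plane) (A : Set Plane) (ω : Ω) : ℕ∞ := {n | X n ω ∈ A}.encard

/-- The random points `X 0, X 1, …` form a homogeneous Poisson point process on the plane with
intensity `lam`: the number of points in a set of finite area is Poisson distributed with mean
`lam` times the area, and the numbers of points in disjoint sets are independent. -/
structure IsPoissonProcess (X : ℕ → Ω → Plane) (lam : ℝ) (P : Measure Ω) : Prop where
  measurable : ∀ n, Measurable (X n)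
  count_law : ∀ A : Set Plane, MeasurableSet A → volume A < ∞ → ∀ k : ℕ,
    P {ω | count X A ω = k} = poissonMeasure (lam * volume.real A).toNNReal {k}
  count_indep : ∀ (n : ℕ) (A : Fin n → Set Plane), (∀ i, MeasurableSet (A i)) →
    Pairwise (fun i j => Disjoint (A i) (A j)) → iIndepFun (fun i => count X (A i)) P

/-- A realisation of the network on the probability space `(Ω, P)`. The typical user is at the
origin. -/
structure Network (p : Params) (P : Measure Ω) where
  /-- locations of the base stations -/
  bs : ℕ → Ω → Plane
  /-- locations of the eavesdroppers -/
  eve : ℕ → Ω → Plane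
  /-- marks (blockage, fading) of the link from base station `i` to the typical user -/
  userMark : ℕ → Ω → ℝ × (LinkType → ℝ)
  /-- marks (angle, (blockage, fading)) of the link from base station `k.1` to eavesdropper
  `k.2` -/
  eveMark : ℕ × ℕ → Ω → ℝ × (ℝ × (LinkType → ℝ))
  bs_poisson : IsPoissonProcess bs p.lamB P
  eve_poisson : IsPoissonProcess eve p.lamE P
  userMark_law : ∀ i, HasLaw (userMark i) p.linkLaw P
  userMark_indep : iIndepFun userMark P
  eveMark_law : ∀ k, HasLaw (eveMark k) p.eveLinkLaw P
  eveMark_indep : iIndepFun eveMark P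
  /- The two point processes and the two families of marks are mutually independent. -/
  indep_bs : IndepFun (fun ω i => bs i ω)
    (fun ω => (fun n => eve n ω, fun i => userMark i ω, fun k => eveMark k ω)) P
  indep_eve : IndepFun (fun ω n => eve n ω)
    (fun ω => (fun i => userMark i ω, fun k => eveMark k ω)) P
  indep_marks : IndepFun (fun ω i => userMark i ω) (fun ω k => eveMark k ω) P

namespace Network

variable {p : Params} {P : Measure Ω} (W : Network p P)

/-- The type of the link from base station `i` to the typical user. -/
def userType (i : ℕ) (ω : Ω) : LinkType := p.linkType (W.userMark i ω).1 ‖W.bs i ω‖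

/-- The path loss `L(x_i, o)` of the link from base station `i` to the typical user. -/
def userLoss (i : ℕ) (ω : Ω) : ℝ := p.pathLoss (W.userType i ω) ‖W.bs i ω‖

/-- The index of the serving base station `x* = argmax L(x, o)`. Almost surely the maximum is
attained exactly once. -/
def serving (ω : Ω) : ℕ := sInf {i | ∀ k, W.userLoss k ω ≤ W.userLoss i ω}

/-- The type of the link from the serving base station to the typical user. -/
def servingType (ω : Ω) : LinkType := W.userType (W.serving ω) ω

/-- The distance from the typical user to its serving base station. -/
def servingDist (ω : Ω) : ℝ := ‖W.bs (W.serving ω) ω‖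

/-- The small-scale channel gain `h_{x* o}`. -/
def servingFading (ω : Ω) : ℝ := (W.userMark (W.serving ω) ω).2 (W.servingType ω)

/-- The type of the link from base station `i` to eavesdropper `n`. -/
def eveType (i n : ℕ) (ω : Ω) : LinkType :=
  p.linkType (W.eveMark (i, n) ω).2.1 (dist (W.bs i ω) (W.eve n ω))

/-- The signal `G_b(θ) L(x_i, z_n) g_{x_i z_n}` of base station `i` received by eavesdropper
`n`. -/
def eveSignal (i n : ℕ) (ω : Ω) : ℝ :=
  p.pattern (W.eveMark (i, n) ω).1 *
    p.pathLoss (W.eveType i n ω) (dist (W.bs i ω) (W.eve n ω)) *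
    (W.eveMark (i, n) ω).2.2 (W.eveType i n ω)

/-- The aggregate signal `I_E` of the serving base station received by all eavesdroppers. -/
def IE (ω : Ω) : ℝ≥0∞ := ∑' n, ENNReal.ofReal (W.eveSignal (W.serving ω) n ω)

/-- The secure connectivity probability `τ_c = Pr(M_s L(x*, o) h_{x* o} / I_E ≥ 1)`. -/
def tauC : ℝ :=
  P.real {ω | 1 ≤ ENNReal.ofReal
    (p.gain Lobe.main * W.userLoss (W.serving ω) ω * W.servingFading ω) / W.IE ω}

/-- The Laplace transform `E[exp(-s I_E)]`. -/
def laplaceIE (s : ℝ) : ℝ := ∫ ω, Real.exp (-s * (W.IE ω).toReal) ∂P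

/-- `A_j`: the probability that the link from the serving base station is of type `j`. -/
def assocProb (j : LinkType) : ℝ := P.real {ω | W.servingType ω = j}

/-- The law of `r_j`: the conditional law of the distance from the typical user to its serving
base station, given that the link between them is of type `j`. -/
def distLaw (j : LinkType) : Measure ℝ :=
  (ProbabilityTheory.cond P {ω | W.servingType ω = j}).map W.servingDist

/-- The term of index `j` under the expectation over the serving distance, as a function of
`r_j`. -/
def tauTerm (j : LinkType) (r : ℝ) : ℝ :=
  ∑ m ∈ Finset.range (p.shape j),
    p.arg j r ^ m * (W.assocProb j / Real.Gamma ((m : ℝ) + 1)) * (-1) ^ m *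
      iteratedDeriv m p.expXi (p.arg j r)

end Network

end

end MmWave

/-! The serving station `x*` is a function of the base station locations and of the blockage of the
links to the user. The eavesdroppers, their marks and all channel gains are independent of these.
Once the former are frozen, `x*` is a fixed point, and the law of `I_E` depends neither on that
point nor on its index: Lebesgue measure is translation invariant and the marks are identically
distributed. Nothing else about the maximiser is used, not even that it exists or is unique.

For a fixed station, `I_E` is a sum over a marked Poisson process, so `E exp(-s I_E) = exp(-λ_E ∫ (1
- ℓ_s(‖x‖)) dx)`, where `ℓ_s(r)` is the Laplace transform of the signal over one link of length `r`
(`lintegral_expNeg_aggregate`). Averaging over lobe, type and gamma fading makes `ℓ_s` a mixture of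
terms `(1 + x) ^ (-N_j)` with `x = s V C_j r ^ (-α_j)`. Telescoping gives `1 - (1 + x) ^ (-N) = ∑_{m
< N} x (1 + x) ^ (-(m + 1))`. In polar coordinates, with `y = r ^ α` inside the disc of radius `D`
and `y = r ^ (-α)` outside, each term becomes an Euler integral for `₂F₁`, and the exponent is
`Ξ(s)` (`integral_near`, `integral_far`). Since `Ξ(s) → 0` as `s → 0+`, the transform tends to `1`,
which forces `I_E < ∞` almost surely.

For `τ_c`, a gain of law gamma(`N`, 1) exceeds `c` with probability `exp(-c) ∑_{m < N} c ^ m / m!`.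
Here `c = s I_E` with `s = r ^ α_j / (M_s C_j)`, and `E[I_E ^ m exp(-s I_E)] = (-1) ^ m L^{(m)}(s)`,
so the conditional probability of secure connection is the sum over `m` in the formula
(`measure_one_le_ratio`). Averaging over `x*` and splitting by its link type gives the claim
(`tauC_eq_sum`). -/

/-! ### Laplace transforms of random variables with values in `[0, ∞]` -/

/-- The function `x ↦ exp (-x)` on `[0, ∞]`. -/
noncomputable def expNeg (x : ℝ≥0∞) : ℝ≥0∞ := (EReal.exp (x : EReal))⁻¹

@[simp] lemma expNeg_zero : expNeg 0 = 1 := by simp [expNeg]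

@[simp] lemma expNeg_top : expNeg ∞ = 0 := by simp [expNeg]

lemma expNeg_ofReal {x : ℝ} (hx : 0 ≤ x) :
    expNeg (ENNReal.ofReal x) = ENNReal.ofReal (Real.exp (-x)) := by
  rw [expNeg, EReal.coe_ennreal_ofReal, max_eq_left hx, EReal.exp_coe, Real.exp_neg,
    ENNReal.ofReal_inv_of_pos (Real.exp_pos x)]

lemma expNeg_coe (x : ℝ≥0) : expNeg x = ENNReal.ofReal (Real.exp (-x)) := by
  rw [← expNeg_ofReal x.coe_nonneg, ENNReal.ofReal_coe_nnreal]

lemma expNeg_eq_ofReal {x : ℝ≥0∞} (hx : x ≠ ∞) :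
    expNeg x = ENNReal.ofReal (Real.exp (-x.toReal)) := by
  rw [← expNeg_ofReal ENNReal.toReal_nonneg, ENNReal.ofReal_toReal hx]

/-- Valid at `∞` too, so series of signals can be handled before their finiteness is known. -/
lemma expNeg_add (x y : ℝ≥0∞) : expNeg (x + y) = expNeg x * expNeg y := by
  have h (z : ℝ≥0∞) : EReal.exp (z : EReal) ≠ 0 := by simp
  rw [expNeg, EReal.coe_ennreal_add, EReal.exp_add, ENNReal.mul_inv (Or.inl (h x)) (Or.inr (h y)),
    expNeg, expNeg]

lemma expNeg_sum {ι : Type*} (s : Finset ι) (f : ι → ℝ≥0∞) :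
    expNeg (∑ i ∈ s, f i) = ∏ i ∈ s, expNeg (f i) := by
  classical
  induction s using Finset.induction_on with
  | empty => simp
  | insert a s ha ih => rw [Finset.sum_insert ha, Finset.prod_insert ha, expNeg_add, ih]

lemma continuous_expNeg : Continuous expNeg :=
  (ENNReal.continuous_exp.comp continuous_coe_ennreal_ereal).inv

@[fun_prop]
lemma measurable_expNeg : Measurable expNeg := continuous_expNeg.measurable

lemma antitone_expNeg : Antitone expNeg := fun x y h => by
  rw [expNeg, expNeg, ENNReal.inv_le_inv]
  exact EReal.exp_monotone (by exact_mod_cast h)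

lemma expNeg_le_one (x : ℝ≥0∞) : expNeg x ≤ 1 := by
  simpa using antitone_expNeg (zero_le (a := x))

/-- A right inverse of `expNeg`. -/
noncomputable def negLog (x : ℝ≥0∞) : ℝ≥0∞ := (ENNReal.log x⁻¹).toENNReal

lemma measurable_negLog : Measurable negLog :=
  (ENNReal.measurable_log.comp measurable_inv).ereal_toENNReal

/-- Turns an infinite product of transforms into `expNeg` of a series in `[0, ∞]`, the form to which
the Laplace functional of a point process applies. -/
lemma expNeg_negLog {x : ℝ≥0∞} (hx : x ≤ 1) : expNeg (negLog x) = x := by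
  rw [expNeg, negLog, EReal.coe_toENNReal, ENNReal.exp_log, inv_inv]
  rw [← ENNReal.log_one]
  exact ENNReal.log_monotone (by simpa using hx)

/-- Dominated convergence with the bound `1`; `expNeg` is continuous at `∞`, so infinite limits are
allowed. -/
lemma tendsto_expNeg_tsum {α : Type*} [MeasurableSpace α] {μ : Measure α} [IsProbabilityMeasure μ]
    {F : ℕ → α → ℝ≥0∞} {G : α → ℝ≥0∞} (hF : ∀ n, AEMeasurable (F n) μ)
    (h : ∀ a, Tendsto (fun n => F n a) atTop (𝓝 (G a))) :
    Tendsto (fun n => ∫⁻ a, expNeg (F n a) ∂μ) atTop (𝓝 (∫⁻ a, expNeg (G a) ∂μ)) := by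
  refine tendsto_lintegral_of_dominated_convergence' (fun _ => 1)
    (fun n => measurable_expNeg.comp_aemeasurable (hF n))
    (fun n => Eventually.of_forall fun a => expNeg_le_one _) (by simp)
    (Eventually.of_forall fun a => (continuous_expNeg.tendsto _).comp (h a))

/-- The Laplace transform of a series of independent nonnegative random variables. -/
lemma lintegral_expNeg_tsum {Ω : Type*} [MeasurableSpace Ω] {P : Measure Ω}
    {Z : ℕ → Ω → ℝ≥0∞} (hZ : ∀ n, Measurable (Z n)) (hind : iIndepFun Z P) :
    ∫⁻ ω, expNeg (∑' n, Z n ω) ∂P = expNeg (∑' n, negLog (∫⁻ ω, expNeg (Z n ω) ∂P)) := by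
  have := hind.isProbabilityMeasure
  have h1 := tendsto_expNeg_tsum (μ := P) (F := fun N ω => ∑ n ∈ Finset.range N, Z n ω)
    (G := fun ω => ∑' n, Z n ω) (fun N => by fun_prop)
    (fun ω => ENNReal.tendsto_nat_tsum _)
  refine tendsto_nhds_unique h1 ?_
  have h2 := (continuous_expNeg.tendsto _).comp
    (ENNReal.tendsto_nat_tsum fun n => negLog (∫⁻ ω, expNeg (Z n ω) ∂P))
  refine h2.congr fun N => ?_
  have h3 (n : ℕ) : ∫⁻ ω, expNeg (Z n ω) ∂P ≤ 1 := by
    calc _ ≤ ∫⁻ ω, 1 ∂P := lintegral_mono fun ω => expNeg_le_one _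
      _ = 1 := by simp
  simp only [Function.comp_apply, expNeg_sum, expNeg_negLog (h3 _)]
  rw [← lintegral_prod_eq_prod_lintegral_of_indepFun (Finset.range N) (fun n ω => expNeg (Z n ω))
    (hind.comp (fun _ => expNeg) fun _ => measurable_expNeg)
    (fun n => measurable_expNeg.comp (hZ n))]

/-! ### Laplace functional of a Poisson process -/

namespace MmWave

variable {Ω : Type*}

lemma tsum_indicator_eq_count (X : ℕ → Ω → Plane) (A : Set Plane) (c : ℝ≥0∞) (ω : Ω) :
    ∑' n, A.indicator (fun _ => c) (X n ω) = c * count X A ω := by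
  rw [count, ← ENNReal.tsum_set_one, tsum_subtype _ (fun _ : ℕ => (1 : ℝ≥0∞)), ← ENNReal.tsum_mul_left]
  refine tsum_congr fun n => ?_
  by_cases h : X n ω ∈ A <;> simp [h]

variable [MeasurableSpace Ω]

lemma IsPoissonProcess.measurable_count {X : ℕ → Ω → Plane} {lam : ℝ} {P : Measure Ω}
    (h : IsPoissonProcess X lam P) {A : Set Plane} (hA : MeasurableSet A) :
    Measurable (count X A) := by
  have h1 : Measurable fun ω => (count X A ω : ℝ≥0∞) := by
    have : (fun ω => (count X A ω : ℝ≥0∞)) = fun ω => ∑' n, A.indicator (fun _ => 1) (X n ω) := by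
      ext ω; rw [tsum_indicator_eq_count, one_mul]
    rw [this]
    exact Measurable.tsum fun n => (measurable_const.indicator hA).comp (h.measurable n)
  refine measurable_to_countable' fun k => ?_
  have : count X A ⁻¹' {k} = (fun ω => (count X A ω : ℝ≥0∞)) ⁻¹' {(k : ℝ≥0∞)} := by
    ext ω; simp
  rw [this]
  exact h1 (measurableSet_singleton _)

lemma IsPoissonProcess.lintegral_expNeg_count {X : ℕ → Ω → Plane} {lam : ℝ} {P : Measure Ω}
    [IsProbabilityMeasure P]
    (hlam : 0 ≤ lam) (h : IsPoissonProcess X lam P) {A : Set Plane} (hA : MeasurableSet A)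
    (hAfin : volume A < ∞) (c : ℝ≥0) :
    ∫⁻ ω, expNeg (c * count X A ω) ∂P
      = expNeg (ENNReal.ofReal lam * ((1 - expNeg c) * volume A)) := by
  -- For `c > 0` an infinite count contributes `expNeg ∞ = 0`, so only finite values matter. For `c
  -- = 0` it would contribute `1`, and the expansion below fails.
  rcases eq_or_ne c 0 with rfl | hc
  · simp
  have hpt (ω : Ω) : expNeg (c * count X A ω)
      = ∑' k : ℕ, (count X A ⁻¹' {(k : ℕ∞)}).indicator (fun _ => expNeg (c * k)) ω := by
    rcases eq_or_ne (count X A ω) ⊤ with ht | ht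
    · have : ((c : ℝ≥0∞) * ∞) = ∞ := ENNReal.mul_top (by simpa using hc)
      simp [ht, this, Set.indicator]
    · lift count X A ω to ℕ using ht with N hN
      rw [tsum_eq_single N]
      · simp [Set.indicator, ← hN]
      · intro k hk
        simp [Set.indicator, ← hN, hk.symm]
  simp_rw [hpt]
  set r : ℝ≥0 := (lam * volume.real A).toNNReal with hr
  have hrr : (r : ℝ) = lam * volume.real A := by
    rw [hr, Real.coe_toNNReal]; positivity
  rw [lintegral_tsum fun k => (measurable_const.indicator
    (h.measurable_count hA (measurableSet_singleton _))).aemeasurable]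
  have hk (k : ℕ) : ∫⁻ ω, (count X A ⁻¹' {(k : ℕ∞)}).indicator (fun _ => expNeg (c * k)) ω ∂P
      = ENNReal.ofReal (Real.exp (-r) * ((r * Real.exp (-c)) ^ k / (Nat.factorial k))) := by
    rw [lintegral_indicator_const (h.measurable_count hA (measurableSet_singleton _))]
    have h1 := h.count_law A hA hAfin k
    have h2 : count X A ⁻¹' {(k : ℕ∞)} = {ω | count X A ω = k} := rfl
    have h3 : (c : ℝ≥0∞) * k = ENNReal.ofReal (c * k) := by
      rw [ENNReal.ofReal_mul c.coe_nonneg]; simp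
    rw [h2, h1, poissonMeasure_singleton, h3, expNeg_ofReal (by positivity),
      ← ENNReal.ofReal_mul (Real.exp_pos _).le]
    congr 1
    rw [mul_pow, ← Real.exp_nat_mul, show (k : ℝ) * -(c : ℝ) = -(c * k) by ring]
    ring
  simp_rw [hk]
  have hs : HasSum (fun k : ℕ => Real.exp (-r) * ((r * Real.exp (-c)) ^ k / (Nat.factorial k)))
      (Real.exp (-r) * Real.exp (r * Real.exp (-c))) := by
    have := NormedSpace.expSeries_div_hasSum_exp (r * Real.exp (-c) : ℝ)
    rw [← Real.exp_eq_exp_ℝ] at this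
    exact this.mul_left _
  rw [← ENNReal.ofReal_tsum_of_nonneg (fun k => by positivity) hs.summable, hs.tsum_eq, expNeg_coe]
  have h4 : (1 : ℝ≥0∞) - ENNReal.ofReal (Real.exp (-c)) = ENNReal.ofReal (1 - Real.exp (-c)) := by
    rw [ENNReal.ofReal_sub _ (Real.exp_pos _).le, ENNReal.ofReal_one]
  have h5 : 0 ≤ 1 - Real.exp (-(c : ℝ)) := by simp
  rw [h4, ← ENNReal.ofReal_toReal hAfin.ne, ← ENNReal.ofReal_mul h5, ← ENNReal.ofReal_mul hlam,
    expNeg_ofReal (by positivity), ← Real.exp_add, hrr]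
  simp only [Measure.real]
  ring_nf

lemma IsPoissonProcess.lintegral_expNeg_sum_count {X : ℕ → Ω → Plane} {lam : ℝ} {P : Measure Ω}
    [IsProbabilityMeasure P] (hlam : 0 ≤ lam) (h : IsPoissonProcess X lam P) {n : ℕ}
    {A : Fin n → Set Plane} (hA : ∀ i, MeasurableSet (A i))
    (hd : Pairwise fun i j => Disjoint (A i) (A j)) (hAfin : ∀ i, volume (A i) < ∞)
    (c : Fin n → ℝ≥0) :
    ∫⁻ ω, expNeg (∑ i, c i * count X (A i) ω) ∂P
      = expNeg (ENNReal.ofReal lam * ∑ i, (1 - expNeg (c i)) * volume (A i)) := by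
  have hg (i : Fin n) : Measurable fun k : ℕ∞ => expNeg (c i * k) := Measurable.of_discrete
  simp_rw [Finset.mul_sum, expNeg_sum, ← h.lintegral_expNeg_count hlam (hA _) (hAfin _)]
  exact lintegral_prod_eq_prod_lintegral_of_indepFun Finset.univ
    (fun i ω => expNeg (c i * count X (A i) ω))
    ((h.count_indep n A hA hd).comp (fun i k => expNeg (c i * k)) hg)
    (fun i => (hg i).comp (h.measurable_count (hA i)))

/-- The level sets of the nonzero values are disjoint, so the sum over points is a combination of
finitely many independent counts. The value `0` is left out because its level set may have infinite
area. -/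
lemma IsPoissonProcess.lintegral_expNeg_simpleFunc {X : ℕ → Ω → Plane} {lam : ℝ} {P : Measure Ω}
    [IsProbabilityMeasure P] (hlam : 0 ≤ lam) (h : IsPoissonProcess X lam P)
    (g : SimpleFunc Plane ℝ≥0∞) (hg : ∀ x, g x ≠ ∞)
    (hsupp : ∀ y, y ≠ 0 → volume (g ⁻¹' {y}) < ∞) :
    ∫⁻ ω, expNeg (∑' n, g (X n ω)) ∂P
      = expNeg (ENNReal.ofReal lam * ∫⁻ x, (1 - expNeg (g x))) := by
  classical
  set s := g.range.filter (· ≠ 0) with hs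
  set e := s.equivFin.symm
  have hmem (i) : (e i : ℝ≥0∞) ∈ g.range ∧ (e i : ℝ≥0∞) ≠ 0 := Finset.mem_filter.1 (e i).2
  have hfin (i) : (e i : ℝ≥0∞) ≠ ∞ := by
    obtain ⟨x, hx⟩ := SimpleFunc.mem_range.1 (hmem i).1
    exact hx ▸ hg x
  -- Needed for `F = id` (the sum over points) and for `F = 1 - expNeg` (the integral).
  have hsum (F : ℝ≥0∞ → ℝ≥0∞) (hF : F 0 = 0) (x : Plane) :
      F (g x) = ∑ i, (g ⁻¹' {(e i : ℝ≥0∞)}).indicator (fun _ => F (e i)) x := by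
    rw [e.sum_comp fun y : s => (g ⁻¹' {(y : ℝ≥0∞)}).indicator (fun _ => F y) x,
      Finset.sum_coe_sort s fun y => (g ⁻¹' {y}).indicator (fun _ => F y) x]
    by_cases hx : g x = 0
    · rw [hx, hF, Finset.sum_eq_zero]
      intro y hy
      have : y ≠ 0 := (Finset.mem_filter.1 hy).2
      simp [Set.indicator, hx, this.symm]
    · rw [Finset.sum_eq_single (g x)]
      · simp
      · intro y _ hy
        simp [Set.indicator, hy.symm]
      · intro hn
        exact absurd (Finset.mem_filter.2 ⟨SimpleFunc.mem_range_self g x, hx⟩) hn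
  have key := h.lintegral_expNeg_sum_count hlam (A := fun i => g ⁻¹' {(e i : ℝ≥0∞)})
    (fun i => g.measurableSet_preimage _)
    (fun i j hij => by
      refine Disjoint.preimage _ (Set.disjoint_singleton.2 fun he => hij ?_)
      exact e.injective (Subtype.ext he))
    (fun i => hsupp _ (hmem i).2) (fun i => (e i : ℝ≥0∞).toNNReal)
  simp only [ENNReal.coe_toNNReal (hfin _)] at key
  have h1 (ω : Ω) : ∑' n, g (X n ω) = ∑ i, (e i : ℝ≥0∞) * count X (g ⁻¹' {(e i : ℝ≥0∞)}) ω := by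
    simp_rw [← tsum_indicator_eq_count]
    rw [← Summable.tsum_finsetSum fun _ _ => ENNReal.summable]
    exact tsum_congr fun n => hsum id rfl _
  have h2 : ∫⁻ x, (1 - expNeg (g x))
      = ∑ i, (1 - expNeg (e i : ℝ≥0∞)) * volume (g ⁻¹' {(e i : ℝ≥0∞)}) := by
    rw [lintegral_congr (hsum (fun y => 1 - expNeg y) (by simp)), lintegral_finsetSum]
    · exact Finset.sum_congr rfl fun i _ =>
        lintegral_indicator_const (g.measurableSet_preimage _) _
    · exact fun i _ => measurable_const.indicator (g.measurableSet_preimage _)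
  simp_rw [h1, h2, key]

/-- The Laplace functional of a homogeneous Poisson point process. -/
theorem IsPoissonProcess.lintegral_expNeg_tsum {X : ℕ → Ω → Plane} {lam : ℝ} {P : Measure Ω}
    [IsProbabilityMeasure P] (hlam : 0 ≤ lam) (h : IsPoissonProcess X lam P)
    {f : Plane → ℝ≥0∞} (hf : Measurable f) :
    ∫⁻ ω, expNeg (∑' n, f (X n ω)) ∂P
      = expNeg (ENNReal.ofReal lam * ∫⁻ x, (1 - expNeg (f x))) := by
  -- Restriction to balls gives the nonzero level sets finite area; `eapprox` keeps the values
  -- finite.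
  set g : ℕ → SimpleFunc Plane ℝ≥0∞ := fun k =>
    (SimpleFunc.eapprox f k).restrict (Metric.ball 0 k) with hg
  have gapp (k : ℕ) (x : Plane) :
      g k x = (Metric.ball 0 k).indicator (SimpleFunc.eapprox f k) x := by
    rw [hg, SimpleFunc.restrict_apply _ measurableSet_ball]
  have gmono (x : Plane) : Monotone fun k => g k x := by
    intro k l hkl
    simp only [gapp]
    refine (Set.indicator_le_indicator (SimpleFunc.monotone_eapprox f hkl x)).trans ?_
    exact Set.indicator_le_indicator_of_subset
      (Metric.ball_subset_ball (by exact_mod_cast hkl)) (fun _ => zero_le) x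
  have gtend (x : Plane) : Tendsto (fun k => g k x) atTop (𝓝 (f x)) := by
    refine (SimpleFunc.tendsto_eapprox hf x).congr' ?_
    obtain ⟨K, hK⟩ := exists_nat_gt ‖x‖
    filter_upwards [eventually_ge_atTop K] with k hk
    have : x ∈ Metric.ball (0 : Plane) k := by
      simpa using hK.trans_le (by exact_mod_cast hk)
    rw [gapp, Set.indicator_of_mem this]
  have hk (k : ℕ) := h.lintegral_expNeg_simpleFunc hlam (g k)
    (fun x => by
      rw [gapp]
      refine (lt_of_le_of_lt ?_ (SimpleFunc.eapprox_lt_top f k x)).ne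
      exact Set.indicator_le_self _ _ x)
    (fun y hy => by
      refine lt_of_le_of_lt (measure_mono ?_) (measure_ball_lt_top (x := (0 : Plane)) (r := k))
      intro x hx
      by_contra hn
      rw [Set.mem_preimage, gapp, Set.indicator_of_notMem hn] at hx
      exact hy hx.symm)
  have h1 : Tendsto (fun k => ∫⁻ ω, expNeg (∑' n, g k (X n ω)) ∂P) atTop
      (𝓝 (∫⁻ ω, expNeg (∑' n, f (X n ω)) ∂P)) := by
    refine tendsto_expNeg_tsum (fun k => Measurable.aemeasurable <| Measurable.tsum fun n =>
      (g k).measurable.comp (h.measurable n)) fun ω => ?_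
    -- A series is an integral against counting measure, so monotone convergence applies to it.
    have := lintegral_tendsto_of_tendsto_of_monotone (μ := (Measure.count : Measure ℕ))
      (f := fun k n => g k (X n ω)) (F := fun n => f (X n ω))
      (fun k => Measurable.of_discrete.aemeasurable)
      (Eventually.of_forall fun n => gmono _) (Eventually.of_forall fun n => gtend _)
    simpa only [lintegral_count] using this
  have h2 : Tendsto (fun k => ∫⁻ x, (1 - expNeg (g k x))) atTop
      (𝓝 (∫⁻ x, (1 - expNeg (f x)))) := by
    refine lintegral_tendsto_of_tendsto_of_monotone
      (fun k => (measurable_const.sub (measurable_expNeg.comp (g k).measurable)).aemeasurable)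
      (Eventually.of_forall fun x k l hkl => tsub_le_tsub_left (antitone_expNeg (gmono x hkl)) _)
      (Eventually.of_forall fun x => ?_)
    exact ENNReal.Tendsto.sub tendsto_const_nhds ((continuous_expNeg.tendsto _).comp (gtend x))
      (Or.inl ENNReal.one_ne_top)
  refine tendsto_nhds_unique h1 ?_
  simp_rw [hk]
  exact (continuous_expNeg.tendsto _).comp
    (ENNReal.Tendsto.const_mul h2 (Or.inr ENNReal.ofReal_ne_top))

/-- A point has area `0`, so its count is Poisson of mean `0`. This keeps the serving distance away
from `0`, where `r ^ (-α)` takes a default value. -/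
lemma IsPoissonProcess.ae_ne_zero {X : ℕ → Ω → Plane} {lam : ℝ} {P : Measure Ω}
    [IsProbabilityMeasure P] (h : IsPoissonProcess X lam P) :
    ∀ᵐ ω ∂P, ∀ n, X n ω ≠ 0 := by
  have h1 := h.count_law {0} (measurableSet_singleton _) (by simp) 0
  simp only [Nat.cast_zero, poissonMeasure_singleton] at h1
  have h2 : P {ω | count X {0} ω = 0} = 1 := by rw [h1]; simp [Measure.real]
  have h3 := (prob_compl_eq_zero_iff
    (h.measurable_count (measurableSet_singleton (0 : Plane)) (measurableSet_singleton 0))).2 h2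
  filter_upwards [measure_eq_zero_iff_ae_notMem.1 h3] with ω hω n hn
  simp only [Set.mem_compl_iff, not_not] at hω
  have : {n | X n ω ∈ ({0} : Set Plane)} = ∅ := Set.encard_eq_zero.1 hω
  exact Set.eq_empty_iff_forall_notMem.1 this n hn

end MmWave

/-! ### Gamma distribution of integer shape -/

/-- The tail `exp (-x) ∑_{m < n} x ^ m / m!` of the gamma distribution of integer shape `n`. -/
noncomputable def erlangTail (n : ℕ) (x : ℝ) : ℝ :=
  Real.exp (-x) * ∑ m ∈ Finset.range n, x ^ m / (Nat.factorial m)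

/-- Differentiation makes consecutive terms cancel; only the top one survives, and it is minus the
gamma density. -/
lemma hasDerivAt_erlangTail (n : ℕ) (x : ℝ) :
    HasDerivAt (erlangTail (n + 1)) (-(Real.exp (-x) * (x ^ n / (Nat.factorial n)))) x := by
  have hexp : HasDerivAt (fun x : ℝ => Real.exp (-x)) (-Real.exp (-x)) x := by
    simpa using (hasDerivAt_neg x).exp
  induction n with
  | zero =>
    have : erlangTail (0 + 1) = fun x => Real.exp (-x) := by ext y; simp [erlangTail]
    rw [this]
    simpa using hexp
  | succ n ih =>
    have h1 : erlangTail (n + 1 + 1) = fun x => erlangTail (n + 1) x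
        + Real.exp (-x) * (x ^ (n + 1) / (Nat.factorial (n + 1))) := by
      ext y; simp only [erlangTail, Finset.sum_range_succ _ (n + 1)]; ring
    rw [h1]
    convert! ih.add (hexp.mul ((hasDerivAt_pow (n + 1) x).div_const _)) using 1
    rw [Nat.factorial_succ]
    have : (Nat.factorial n : ℝ) ≠ 0 := by positivity
    push_cast
    field_simp
    simp

lemma tendsto_erlangTail (n : ℕ) : Tendsto (erlangTail n) atTop (𝓝 0) := by
  have : erlangTail n = fun x => ∑ m ∈ Finset.range n,
      x ^ m * Real.exp (-x) * (Nat.factorial m : ℝ)⁻¹ := by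
    ext x; rw [erlangTail, Finset.mul_sum]; exact Finset.sum_congr rfl fun m _ => by ring
  rw [this, show (0 : ℝ) = ∑ m ∈ Finset.range n, 0 * (Nat.factorial m : ℝ)⁻¹ by simp]
  exact tendsto_finsetSum _ fun m _ =>
    (Real.tendsto_pow_mul_exp_neg_atTop_nhds_zero m).mul_const _

lemma gammaPDF_natCast_one (n : ℕ) {x : ℝ} (hx : 0 ≤ x) :
    gammaPDF ((n + 1 : ℕ) : ℝ) 1 x
      = ENNReal.ofReal (Real.exp (-x) * (x ^ n / (Nat.factorial n))) := by
  rw [gammaPDF_of_nonneg hx]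
  congr 1
  push_cast
  rw [Real.Gamma_nat_eq_factorial, Real.one_rpow, add_sub_cancel_right, Real.rpow_natCast, one_mul]
  ring

lemma gammaMeasure_Ici {n : ℕ} (hn : 0 < n) {c : ℝ} (hc : 0 ≤ c) :
    gammaMeasure n 1 (Ici c) = ENNReal.ofReal (erlangTail n c) := by
  obtain ⟨k, rfl⟩ := Nat.exists_eq_succ_of_ne_zero hn.ne'
  rw [gammaMeasure, withDensity_apply _ measurableSet_Ici, setLIntegral_congr Ioi_ae_eq_Ici.symm,
    setLIntegral_congr_fun measurableSet_Ioi
      fun x hx => gammaPDF_natCast_one k (hc.trans (le_of_lt hx))]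
  have hd (x : ℝ) : HasDerivAt (fun x => -erlangTail (k + 1) x)
      (Real.exp (-x) * (x ^ k / (Nat.factorial k))) x := by
    have := (hasDerivAt_erlangTail k x).fun_neg
    rwa [neg_neg] at this
  have hnn : ∀ x ∈ Ioi c, 0 ≤ Real.exp (-x) * (x ^ k / (Nat.factorial k)) := fun x hx => by
    have : 0 ≤ x := hc.trans (le_of_lt hx)
    positivity
  have ht : Tendsto (fun x => -erlangTail (k + 1) x) atTop (𝓝 0) := by
    simpa using (tendsto_erlangTail (k + 1)).neg
  have hint := integrableOn_Ioi_deriv_of_nonneg' (a := c) (fun x _ => hd x) hnn ht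
  rw [← ofReal_integral_eq_lintegral_ofReal hint
    ((ae_restrict_iff' measurableSet_Ioi).2 (Eventually.of_forall hnn)),
    integral_Ioi_of_hasDerivAt_of_nonneg' (a := c) (fun x _ => hd x) hnn ht]
  simp

lemma gammaMeasure_Iic_zero (a r : ℝ) : gammaMeasure a r (Iic 0) = 0 := by
  rw [gammaMeasure, withDensity_apply _ measurableSet_Iic, setLIntegral_congr Iio_ae_eq_Iic.symm]
  exact lintegral_gammaPDF_of_nonpos le_rfl

/-- The Laplace transform of the gamma distribution of integer shape. -/
lemma lintegral_expNeg_gammaMeasure {n : ℕ} (hn : 0 < n) {t : ℝ} (ht : 0 ≤ t) :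
    ∫⁻ x, expNeg (ENNReal.ofReal (t * x)) ∂(gammaMeasure n 1)
      = ENNReal.ofReal (((1 + t) ^ n)⁻¹) := by
  have hn' : (0 : ℝ) < n := by exact_mod_cast hn
  rw [gammaMeasure, lintegral_withDensity_eq_lintegral_mul _ (f := gammaPDF n 1)
    (measurable_gammaPDFReal _ _).ennreal_ofReal
    (g := fun x => expNeg (ENNReal.ofReal (t * x))) (by fun_prop)]
  -- Tilting by `exp (-t x)` changes the rate from `1` to `1 + t`, at the price of the normalising
  -- factor `(1 + t) ^ (-n)`.
  have h1 (x : ℝ) : (gammaPDF n 1 * fun x => expNeg (ENNReal.ofReal (t * x))) x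
      = ENNReal.ofReal (((1 + t) ^ n)⁻¹) * gammaPDF n (1 + t) x := by
    rw [Pi.mul_apply]
    rcases lt_or_ge x 0 with hx | hx
    · simp [gammaPDF_of_neg hx]
    · have hpos : 0 < Real.Gamma n := Real.Gamma_pos_of_pos hn'
      rw [gammaPDF_of_nonneg hx, gammaPDF_of_nonneg hx, expNeg_ofReal (by positivity),
        ← ENNReal.ofReal_mul (by positivity), ← ENNReal.ofReal_mul (by positivity)]
      congr 1
      rw [Real.one_rpow, Real.rpow_natCast]
      have : Real.exp (-((1 + t) * x)) = Real.exp (-(1 * x)) * Real.exp (-(t * x)) := by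
        rw [← Real.exp_add]; ring_nf
      rw [this]
      field_simp
  rw [lintegral_congr h1, lintegral_const_mul _ (f := gammaPDF n (1 + t))
    (measurable_gammaPDFReal _ _).ennreal_ofReal,
    lintegral_gammaPDF_eq_one hn' (by positivity), mul_one]

/-! ### Laplace transform of the signal over one link -/

lemma lintegral_ite_const {α : Type*} [MeasurableSpace α] (μ : Measure α) {p : α → Prop}
    [DecidablePred p] (hp : MeasurableSet {x | p x}) (a b : ℝ≥0∞) :
    ∫⁻ x, (if p x then a else b) ∂μ = a * μ {x | p x} + b * μ {x | p x}ᶜ := by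
  have : (fun x => if p x then a else b)
      = fun x => {x | p x}.indicator (fun _ => a) x + {x | p x}ᶜ.indicator (fun _ => b) x := by
    ext x; by_cases hx : p x <;> simp [hx]
  rw [this, lintegral_add_left (measurable_const.indicator hp), lintegral_indicator_const hp,
    lintegral_indicator_const hp.compl]

namespace MmWave

instance (p : Params) (j : LinkType) : IsProbabilityMeasure (gammaMeasure (p.shape j) 1) :=
  isProbabilityMeasure_gammaMeasure (by exact_mod_cast p.shape_pos j) one_pos

instance : IsProbabilityMeasure (ProbabilityTheory.cond volume (Icc (0 : ℝ) 1)) :=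
  cond_isProbabilityMeasure_of_finite (by simp) (by simp)

instance : IsProbabilityMeasure (ProbabilityTheory.cond volume (Icc (-180 : ℝ) 180)) :=
  cond_isProbabilityMeasure_of_finite (by simp) (by simp)

namespace Params

variable (p : Params)

instance : IsProbabilityMeasure p.linkLaw := by unfold linkLaw; infer_instance

instance : IsProbabilityMeasure p.eveLinkLaw := by unfold eveLinkLaw; infer_instance

/-- The probability that a link of length `r` has type `j`. -/
noncomputable def typeProb (r : ℝ) : LinkType → ℝ
  | LinkType.los => p.losProb r
  | LinkType.nlos => 1 - p.losProb r

lemma losProb_nonneg (r : ℝ) : 0 ≤ p.losProb r := by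
  unfold losProb; split_ifs; exacts [p.C_nonneg, le_rfl]

lemma losProb_le_one (r : ℝ) : p.losProb r ≤ 1 := by
  unfold losProb; split_ifs; exacts [p.C_le_one, zero_le_one]

lemma measurable_losProb : Measurable p.losProb :=
  Measurable.ite measurableSet_Iic measurable_const measurable_const

lemma typeProb_nonneg (r : ℝ) (j : LinkType) : 0 ≤ p.typeProb r j := by
  cases j
  exacts [p.losProb_nonneg r, sub_nonneg.2 (p.losProb_le_one r)]

lemma lobeProb_nonneg (V : Lobe) : 0 ≤ p.lobeProb V := by
  cases V
  exacts [div_nonneg p.beam_nonneg (by norm_num),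
    div_nonneg (sub_nonneg.2 p.beam_le) (by norm_num)]

lemma sum_typeProb (r : ℝ) : ∑ j, p.typeProb r j = 1 := by
  change ∑ j ∈ {LinkType.los, LinkType.nlos}, p.typeProb r j = 1
  rw [Finset.sum_pair (by decide)]
  simp [typeProb]

lemma sum_lobeProb : ∑ V, p.lobeProb V = 1 := by
  change ∑ j ∈ {Lobe.main, Lobe.side}, p.lobeProb j = 1
  rw [Finset.sum_pair (by decide)]
  simp only [lobeProb]
  ring

lemma pathLoss_nonneg (j : LinkType) {r : ℝ} (hr : 0 ≤ r) : 0 ≤ p.pathLoss j r :=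
  mul_nonneg (p.coef_pos j).le (Real.rpow_nonneg hr _)

lemma pathLoss_pos (j : LinkType) {r : ℝ} (hr : 0 < r) : 0 < p.pathLoss j r :=
  mul_pos (p.coef_pos j) (Real.rpow_pos_of_pos hr _)

lemma measurable_pathLoss (j : LinkType) : Measurable (p.pathLoss j) := by
  unfold pathLoss; fun_prop

lemma measurable_pattern : Measurable p.pattern := by
  unfold pattern
  exact Measurable.ite (measurableSet_le (by fun_prop) measurable_const)
    measurable_const measurable_const

/-- The signal received over a link of length `r` with marks `k`. -/
noncomputable def signal (r : ℝ) (k : ℝ × (ℝ × (LinkType → ℝ))) : ℝ :=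
  p.pattern k.1 * p.pathLoss (p.linkType k.2.1 r) r * k.2.2 (p.linkType k.2.1 r)

lemma measurable_signal : Measurable (Function.uncurry p.signal) := by
  have : Function.uncurry p.signal = fun x => if x.2.2.1 < p.losProb x.1 then
      p.pattern x.2.1 * p.pathLoss LinkType.los x.1 * x.2.2.2 LinkType.los else
      p.pattern x.2.1 * p.pathLoss LinkType.nlos x.1 * x.2.2.2 LinkType.nlos := by
    ext ⟨r, k⟩
    simp only [Function.uncurry, signal, linkType]
    split_ifs <;> rfl
  rw [this]
  have h1 := p.measurable_pattern
  have h2 := p.measurable_pathLoss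
  have h3 := p.measurable_losProb
  exact Measurable.ite (measurableSet_lt (by fun_prop) (by fun_prop))
    (by fun_prop) (by fun_prop)

/-- The Laplace transform of the signal received over a link of length `r`. -/
noncomputable def linkLaplace (s r : ℝ) : ℝ :=
  ∑ V, p.lobeProb V * ∑ j, p.typeProb r j * ((1 + s * (p.gain V * p.pathLoss j r)) ^ p.shape j)⁻¹

lemma linkLaplace_inner_le_one {s r : ℝ} (hs : 0 ≤ s) (hr : 0 ≤ r) (V : Lobe) (j : LinkType) :
    ((1 + s * (p.gain V * p.pathLoss j r)) ^ p.shape j)⁻¹ ≤ 1 := by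
  have := p.gain_pos V
  have := p.pathLoss_nonneg j hr
  exact inv_le_one_of_one_le₀ (one_le_pow₀ (by nlinarith [mul_nonneg hs (mul_nonneg (p.gain_pos V).le this)]))

lemma linkLaplace_nonneg {s r : ℝ} (hs : 0 ≤ s) (hr : 0 ≤ r) : 0 ≤ p.linkLaplace s r := by
  refine Finset.sum_nonneg fun V _ => mul_nonneg (p.lobeProb_nonneg V) (Finset.sum_nonneg fun j _ =>
    mul_nonneg (p.typeProb_nonneg r j) ?_)
  have := p.gain_pos V
  have := p.pathLoss_nonneg j hr
  positivity

lemma uniform_Iio {q : ℝ} (h1 : q ≤ 1) :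
    ProbabilityTheory.cond volume (Icc (0 : ℝ) 1) (Iio q) = ENNReal.ofReal q := by
  rw [cond_apply measurableSet_Icc]
  have : Icc (0 : ℝ) 1 ∩ Iio q = Ico 0 q := by
    ext x; simp only [mem_inter_iff, mem_Icc, mem_Iio, mem_Ico]
    constructor
    · rintro ⟨⟨a, b⟩, c⟩; exact ⟨a, c⟩
    · rintro ⟨a, c⟩; exact ⟨⟨a, by linarith⟩, c⟩
  rw [this]
  simp

lemma uniform_abs_le : ProbabilityTheory.cond volume (Icc (-180 : ℝ) 180) {θ | |θ| ≤ p.beam}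
    = ENNReal.ofReal (p.beam / 180) := by
  rw [cond_apply measurableSet_Icc]
  have : Icc (-180 : ℝ) 180 ∩ {θ | |θ| ≤ p.beam} = Icc (-p.beam) p.beam := by
    ext x; simp only [mem_inter_iff, mem_Icc, mem_ofPred_eq, abs_le]
    have := p.beam_le
    constructor
    · rintro ⟨_, c⟩; exact c
    · rintro ⟨a, c⟩; exact ⟨⟨by linarith, by linarith⟩, a, c⟩
  rw [this, Real.volume_Icc, Real.volume_Icc, ← ENNReal.ofReal_inv_of_pos (by norm_num),
    ← ENNReal.ofReal_mul (by norm_num)]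
  congr 1
  ring

lemma lintegral_uniform_lt {q : ℝ} (h0 : 0 ≤ q) (h1 : q ≤ 1) (a b : ℝ≥0∞) :
    ∫⁻ u, (if u < q then a else b) ∂(ProbabilityTheory.cond volume (Icc (0 : ℝ) 1))
      = ENNReal.ofReal q * a + ENNReal.ofReal (1 - q) * b := by
  have h2 : {u : ℝ | u < q} = Iio q := rfl
  rw [lintegral_ite_const _ (p := fun u : ℝ => u < q) measurableSet_Iio, h2,
    prob_compl_eq_one_sub measurableSet_Iio, uniform_Iio h1, ENNReal.ofReal_sub _ h0, ENNReal.ofReal_one, mul_comm a, mul_comm b]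

lemma lintegral_uniform_abs_le (a b : ℝ≥0∞) :
    ∫⁻ θ, (if |θ| ≤ p.beam then a else b) ∂(ProbabilityTheory.cond volume (Icc (-180 : ℝ) 180))
      = ENNReal.ofReal (p.lobeProb Lobe.main) * a + ENNReal.ofReal (p.lobeProb Lobe.side) * b := by
  have hm : MeasurableSet {θ : ℝ | |θ| ≤ p.beam} := measurableSet_le (by fun_prop) measurable_const
  rw [lintegral_ite_const _ (p := fun θ : ℝ => |θ| ≤ p.beam) hm, prob_compl_eq_one_sub hm,
    p.uniform_abs_le, mul_comm a, mul_comm b]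
  have : p.lobeProb Lobe.side = 1 - p.beam / 180 := by simp only [lobeProb]; ring
  rw [this, ENNReal.ofReal_sub _ (div_nonneg p.beam_nonneg (by norm_num)), ENNReal.ofReal_one]
  rfl

lemma lintegral_expNeg_fading (j : LinkType) {t : ℝ} (ht : 0 ≤ t) :
    ∫⁻ g : LinkType → ℝ, expNeg (ENNReal.ofReal (t * g j))
        ∂(Measure.pi fun j => gammaMeasure (p.shape j) 1)
      = ENNReal.ofReal (((1 + t) ^ p.shape j)⁻¹) := by
  rw [← lintegral_expNeg_gammaMeasure (p.shape_pos j) ht]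
  exact (measurePreserving_eval (fun j => gammaMeasure (p.shape j) 1) j).lintegral_comp
    (f := fun x => expNeg (ENNReal.ofReal (t * x))) (measurable_expNeg.comp (by fun_prop))

/-- Once the blockage variable is fixed, so is the type, and only the gain of that type enters.
Integrating it first leaves a function of the blockage with two values. -/
lemma lintegral_expNeg_link {s r t : ℝ} (hs : 0 ≤ s) (hr : 0 ≤ r) (ht : 0 ≤ t) :
    ∫⁻ k, expNeg (ENNReal.ofReal
        (s * (t * p.pathLoss (p.linkType k.1 r) r * k.2 (p.linkType k.1 r)))) ∂p.linkLaw
      = ENNReal.ofReal (∑ j, p.typeProb r j * ((1 + s * (t * p.pathLoss j r)) ^ p.shape j)⁻¹) := by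
  have hm : Measurable fun k : ℝ × (LinkType → ℝ) => expNeg (ENNReal.ofReal
        (s * (t * p.pathLoss (p.linkType k.1 r) r * k.2 (p.linkType k.1 r)))) := by
    refine measurable_expNeg.comp (Measurable.ennreal_ofReal ?_)
    have : (fun k : ℝ × (LinkType → ℝ) =>
        s * (t * p.pathLoss (p.linkType k.1 r) r * k.2 (p.linkType k.1 r))) =
        fun k => if k.1 < p.losProb r then s * (t * p.pathLoss LinkType.los r * k.2 LinkType.los)
          else s * (t * p.pathLoss LinkType.nlos r * k.2 LinkType.nlos) := by
      ext k
      simp only [linkType]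
      split_ifs <;> rfl
    rw [this]
    exact Measurable.ite (measurableSet_lt (by fun_prop) (by fun_prop))
      (by fun_prop) (by fun_prop)
  have hnn (j : LinkType) : 0 ≤ s * (t * p.pathLoss j r) :=
    mul_nonneg hs (mul_nonneg ht (p.pathLoss_nonneg j hr))
  rw [linkLaw, lintegral_prod _ hm.aemeasurable]
  have h1 (u : ℝ) : ∫⁻ g : LinkType → ℝ, expNeg (ENNReal.ofReal
        (s * (t * p.pathLoss (p.linkType u r) r * g (p.linkType u r))))
        ∂(Measure.pi fun j => gammaMeasure (p.shape j) 1)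
      = if u < p.losProb r then
          ENNReal.ofReal (((1 + s * (t * p.pathLoss LinkType.los r)) ^ p.shape LinkType.los)⁻¹)
        else
          ENNReal.ofReal (((1 + s * (t * p.pathLoss LinkType.nlos r)) ^ p.shape LinkType.nlos)⁻¹) := by
    simp_rw [← mul_assoc s (t * p.pathLoss _ r)]
    rw [p.lintegral_expNeg_fading _ (hnn _)]
    unfold linkType
    split_ifs <;> rfl
  simp only [h1]
  rw [lintegral_uniform_lt (p.losProb_nonneg r) (p.losProb_le_one r)]
  change _ = ENNReal.ofReal (∑ j ∈ {LinkType.los, LinkType.nlos}, _)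
  have h2 (j : LinkType) : 0 ≤ ((1 + s * (t * p.pathLoss j r)) ^ p.shape j)⁻¹ := by
    have := hnn j
    positivity
  rw [Finset.sum_pair (by decide), ENNReal.ofReal_add
    (mul_nonneg (p.typeProb_nonneg r _) (h2 _)) (mul_nonneg (p.typeProb_nonneg r _) (h2 _)),
    ENNReal.ofReal_mul (p.typeProb_nonneg r _), ENNReal.ofReal_mul (p.typeProb_nonneg r _)]
  rfl

lemma lintegral_expNeg_signal {s r : ℝ} (hs : 0 ≤ s) (hr : 0 ≤ r) :
    ∫⁻ k, expNeg (ENNReal.ofReal s * ENNReal.ofReal (p.signal r k)) ∂p.eveLinkLaw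
      = ENNReal.ofReal (p.linkLaplace s r) := by
  have hsig : Measurable (p.signal r) := p.measurable_signal.of_uncurry_left
  simp only [← ENNReal.ofReal_mul hs]
  have hm : Measurable fun k => expNeg (ENNReal.ofReal (s * p.signal r k)) := by fun_prop
  rw [eveLinkLaw, lintegral_prod _ hm.aemeasurable]
  have h1 (θ : ℝ) : ∫⁻ k, expNeg (ENNReal.ofReal (s * p.signal r (θ, k))) ∂p.linkLaw
      = if |θ| ≤ p.beam then ENNReal.ofReal (∑ j, p.typeProb r j *
          ((1 + s * (p.gain Lobe.main * p.pathLoss j r)) ^ p.shape j)⁻¹)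
        else ENNReal.ofReal (∑ j, p.typeProb r j *
          ((1 + s * (p.gain Lobe.side * p.pathLoss j r)) ^ p.shape j)⁻¹) := by
    have h2 := p.lintegral_expNeg_link hs hr (t := p.pattern θ)
      (by unfold pattern; split_ifs <;> exact (p.gain_pos _).le)
    simp only [signal]
    rw [h2]
    unfold pattern
    split_ifs <;> rfl
  simp only [h1]
  rw [p.lintegral_uniform_abs_le]
  unfold linkLaplace
  change _ = ENNReal.ofReal (∑ j ∈ {Lobe.main, Lobe.side}, _)
  have h2 (V : Lobe) : 0 ≤ ∑ j, p.typeProb r j *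
      ((1 + s * (p.gain V * p.pathLoss j r)) ^ p.shape j)⁻¹ :=
    Finset.sum_nonneg fun j _ => by
      have := p.gain_pos V
      have := p.pathLoss_nonneg j hr
      have := p.typeProb_nonneg r j
      positivity
  rw [Finset.sum_pair (by decide), ENNReal.ofReal_add
    (mul_nonneg (p.lobeProb_nonneg _) (h2 _)) (mul_nonneg (p.lobeProb_nonneg _) (h2 _)),
    ENNReal.ofReal_mul (p.lobeProb_nonneg _), ENNReal.ofReal_mul (p.lobeProb_nonneg _)]

end Params

end MmWave

/-! ### Euler integrals and the hypergeometric series -/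

/-- The coefficient `(b)ₙ / (c)ₙ` of the hypergeometric series `₂F₁(1, b; c; ·)`. -/
noncomputable def pochhammerRatio (b c : ℝ) : ℕ → ℝ
  | 0 => 1
  | n + 1 => pochhammerRatio b c n * ((b + n) / (c + n))

/-- With first parameter `1`, `(1)ₙ = n!` cancels the factorial of the Gauss series. -/
lemma pochhammerRatio_eq (b c : ℝ) (n : ℕ) :
    (Nat.factorial n : ℝ)⁻¹ * (ascPochhammer ℝ n).eval 1 * (ascPochhammer ℝ n).eval b *
      ((ascPochhammer ℝ n).eval c)⁻¹ = pochhammerRatio b c n := by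
  induction n with
  | zero => simp [pochhammerRatio]
  | succ n ih =>
    rw [pochhammerRatio, ← ih]
    simp only [ascPochhammer_succ_eval, Nat.factorial_succ, Nat.cast_mul, Nat.cast_add,
      Nat.cast_one, mul_inv]
    have h : (n : ℝ) + 1 ≠ 0 := by positivity
    field_simp
    ring

lemma hasSum_ordinaryHypergeometric_one {b c x : ℝ} (hb : 0 < b) (hc : 0 < c) (hx : |x| < 1) :
    HasSum (fun n => pochhammerRatio b c n * x ^ n) (ordinaryHypergeometric (1 : ℝ) b c x) := by
  have hr := ordinaryHypergeometricSeries_radius_eq_one (𝕂 := ℝ) ℝ 1 b c fun k => by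
    have : (0 : ℝ) ≤ k := k.cast_nonneg
    exact ⟨by linarith, by linarith, by linarith⟩
  have hmem : x ∈ Metric.eball (0 : ℝ) (ordinaryHypergeometricSeries ℝ 1 b c).radius := by
    rw [hr, mem_eball_zero_iff, ← ofReal_norm, Real.norm_eq_abs]
    exact_mod_cast ENNReal.ofReal_lt_one.2 hx
  have := (ordinaryHypergeometricSeries ℝ 1 b c).hasSum hmem
  simp only [ordinaryHypergeometricSeries_apply_eq, smul_eq_mul, pochhammerRatio_eq] at this
  exact this

/-- Both sides are `(b)ₙ / (a)ₙ₊₁`. Iterated integration by parts produces the left form, the series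
with lower parameter `a + 1` the right one. -/
lemma pochhammerRatio_shift {a b : ℝ} (ha : 0 < a) (n : ℕ) :
    pochhammerRatio b a n / (a + n) = pochhammerRatio b (a + 1) n / a := by
  induction n with
  | zero => simp [pochhammerRatio]
  | succ n ih =>
    rw [pochhammerRatio, pochhammerRatio]
    have h1 : a + n ≠ 0 := by positivity
    have h2 : a + 1 + n ≠ 0 := by positivity
    have h3 : a + (n + 1 : ℕ) = a + 1 + n := by push_cast; ring
    rw [div_eq_div_iff h1 ha.ne'] at ih
    rw [h3]
    field_simp
    linear_combination (b + n) * ih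

lemma intervalIntegrable_rpow_div {a s T : ℝ} (ha : 0 < a) (hs : 0 < s) (hT : 0 ≤ T) (n : ℕ) :
    IntervalIntegrable (fun t => t ^ (a - 1) * ((t + s) ^ n)⁻¹) volume 0 T := by
  refine (intervalIntegral.intervalIntegrable_rpow' (by linarith)).mul_continuousOn ?_
  rw [uIcc_of_le hT]
  refine ContinuousOn.inv₀ (by fun_prop) fun t ht => ?_
  have : 0 < t + s := add_pos_of_nonneg_of_pos ht.1 hs
  positivity

/-- Integration by parts; the boundary term at `0` vanishes because `a > 0`. -/
lemma integral_rpow_div_succ {a s T : ℝ} (ha : 0 < a) (hs : 0 < s) (hT : 0 < T) (n : ℕ) :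
    ∫ t in 0..T, t ^ (a - 1) * ((t + s) ^ n)⁻¹
      = T ^ a / (a * (s + T) ^ n) + n / a * ∫ t in 0..T, t ^ (a + 1 - 1) * ((t + s) ^ (n + 1))⁻¹ := by
  have hi1 := intervalIntegrable_rpow_div ha hs hT.le n
  have hi2 := (intervalIntegrable_rpow_div (a := a + 1) (by linarith) hs hT.le (n + 1)).const_mul
    ((n : ℝ) / a)
  have hftc := intervalIntegral.integral_eq_sub_of_hasDerivAt_of_le (a := 0) (b := T)
    (f := fun t => t ^ a / a * ((t + s) ^ n)⁻¹)
    (f' := fun t => t ^ (a - 1) * ((t + s) ^ n)⁻¹ -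
      n / a * (t ^ (a + 1 - 1) * ((t + s) ^ (n + 1))⁻¹)) hT.le
    (by
      refine ContinuousOn.mul (ContinuousOn.div_const
        (continuousOn_id.rpow_const fun t _ => Or.inr ha.le) _) (ContinuousOn.inv₀ (by fun_prop) fun t ht => ?_)
      have : 0 < t + s := add_pos_of_nonneg_of_pos ht.1 hs
      positivity)
    (fun t ht => by
      have hts : 0 < t + s := add_pos ht.1 hs
      have h1 : HasDerivAt (fun t : ℝ => t ^ a / a) (t ^ (a - 1)) t := by
        convert! (Real.hasDerivAt_rpow_const (p := a) (Or.inl ht.1.ne')).div_const a using 1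
        field_simp
      have h2 : HasDerivAt (fun t : ℝ => ((t + s) ^ n)⁻¹) (-(n * ((t + s) ^ (n + 1))⁻¹)) t := by
        have h3 : HasDerivAt (fun t : ℝ => (t + s) ^ n) (n * (t + s) ^ (n - 1)) t := by
          simpa using ((hasDerivAt_id t).add_const s).fun_pow n
        convert! h3.fun_inv (by positivity) using 1
        rcases n with _ | n
        · simp
        · simp only [Nat.add_sub_cancel]
          field_simp
          ring
      convert! h1.mul h2 using 1
      rw [add_sub_cancel_right]
      ring)
    (hi1.sub hi2)
  rw [intervalIntegral.integral_sub hi1 hi2, intervalIntegral.integral_const_mul] at hftc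
  rw [sub_eq_iff_eq_add] at hftc
  rw [hftc]
  congr 1
  rw [Real.zero_rpow ha.ne', add_comm T s]
  field_simp
  simp

/-- Euler's integral for `₂F₁(1, m + 1; a + 1; ·)`. -/
lemma integral_rpow_div_eq_hypergeometric {a s T : ℝ} (ha : 0 < a) (hs : 0 < s) (hT : 0 < T)
    (m : ℕ) :
    ∫ t in 0..T, t ^ (a - 1) * ((t + s) ^ (m + 1))⁻¹
      = T ^ a / (a * (s + T) ^ (m + 1)) *
        ordinaryHypergeometric (1 : ℝ) ((m : ℝ) + 1) (a + 1) (T / (T + s)) := by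
  set x := T / (T + s) with hx
  have hx0 : 0 < x := by positivity
  have hx1 : x < 1 := by rw [hx, div_lt_one (by positivity)]; linarith
  have habs : |x| < 1 := by rwa [abs_of_pos hx0]
  have hb : (0 : ℝ) < (m : ℝ) + 1 := by positivity
  set J : ℕ → ℝ := fun n => ∫ t in 0..T, t ^ (a + n - 1) * ((t + s) ^ (m + 1 + n))⁻¹ with hJ
  have hrec (n : ℕ) : J n = T ^ (a + n) / ((a + n) * (s + T) ^ (m + 1 + n))
      + ((m : ℝ) + 1 + n) / (a + n) * J (n + 1) := by
    have := integral_rpow_div_succ (a := a + n) (by positivity) hs hT (m + 1 + n)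
    simp only [hJ]
    rw [this]
    push_cast
    ring_nf
  -- After `n` integrations by parts: a partial sum of the hypergeometric series plus a remainder.
  have hsum (n : ℕ) : J 0 = ∑ k ∈ Finset.range n, T ^ a / (a * (s + T) ^ (m + 1)) *
        (pochhammerRatio ((m : ℝ) + 1) (a + 1) k * x ^ k)
      + pochhammerRatio ((m : ℝ) + 1) a n * J n := by
    induction n with
    | zero => simp [pochhammerRatio]
    | succ n ih =>
      have hterm : T ^ a / (a * (s + T) ^ (m + 1)) * (pochhammerRatio ((m : ℝ) + 1) (a + 1) n * x ^ n)
          = pochhammerRatio ((m : ℝ) + 1) a n * (T ^ (a + n) / ((a + n) * (s + T) ^ (m + 1 + n))) := by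
        have h1 := pochhammerRatio_shift (b := (m : ℝ) + 1) ha n
        have h2 : a + n ≠ 0 := by positivity
        rw [Real.rpow_add hT, Real.rpow_natCast, hx, div_pow, add_comm T s, pow_add (s + T) (m + 1) n]
        rw [div_eq_div_iff h2 ha.ne'] at h1
        field_simp
        linear_combination -h1
      rw [Finset.sum_range_succ, ih, hrec n, pochhammerRatio]
      linear_combination -hterm
  have hJ0 (n : ℕ) : 0 ≤ J n := by
    refine intervalIntegral.integral_nonneg hT.le fun t ht => ?_
    have : 0 ≤ t := ht.1
    positivity
  -- The integrand of `J n` is that of `J 0` times `(t / (t + s)) ^ n`, and `t / (t + s) ≤ x` on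
  -- `(0, T]`. The endpoint `t = 0` is separate because splitting the real power needs `t > 0`.
  have hJle (n : ℕ) : J n ≤ x ^ n * J 0 := by
    simp only [hJ]
    rw [← intervalIntegral.integral_const_mul]
    refine intervalIntegral.integral_mono_on hT.le
      (intervalIntegrable_rpow_div (by positivity) hs hT.le _)
      (by simpa using (intervalIntegrable_rpow_div ha hs hT.le (m + 1)).const_mul (x ^ n)) ?_
    intro t ht
    rcases ht.1.eq_or_lt with h0 | h0
    · rw [← h0]
      rcases n with _ | n
      · simp
      · have : a + ((n + 1 : ℕ) : ℝ) - 1 ≠ 0 := by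
          push_cast
          linarith [n.cast_nonneg (α := ℝ)]
        rw [Real.zero_rpow this]
        have : 0 ≤ (0 : ℝ) ^ (a + ((0 : ℕ) : ℝ) - 1) := Real.rpow_nonneg le_rfl _
        rw [zero_mul]
        exact mul_nonneg (by positivity) (mul_nonneg this (by positivity))
    · have h1 : t ^ (a + n - 1) = t ^ (a + ((0 : ℕ) : ℝ) - 1) * t ^ n := by
        rw [← Real.rpow_natCast t n, ← Real.rpow_add h0]
        congr 1
        push_cast
        ring
      have h2 : (t / (t + s)) ^ n ≤ x ^ n := by
        refine pow_le_pow_left₀ (by positivity) ?_ n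
        rw [hx, div_le_div_iff₀ (by positivity) (by positivity)]
        nlinarith [ht.2]
      calc _ = (t / (t + s)) ^ n * (t ^ (a + ((0 : ℕ) : ℝ) - 1) * ((t + s) ^ (m + 1 + 0))⁻¹) := by
            rw [h1, div_pow, pow_add (t + s) (m + 1) n, add_zero]
            field_simp
        _ ≤ _ := mul_le_mul_of_nonneg_right h2 (by positivity)
  have hsumm := (hasSum_ordinaryHypergeometric_one hb ha habs).summable
  have hlim : Tendsto (fun n => pochhammerRatio ((m : ℝ) + 1) a n * J n) atTop
      (𝓝 0) := by
    have hz := hsumm.tendsto_atTop_zero.mul_const (J 0)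
    rw [zero_mul] at hz
    have hc (n : ℕ) : 0 ≤ pochhammerRatio ((m : ℝ) + 1) a n := by
      induction n with
      | zero => simp [pochhammerRatio]
      | succ n ih => rw [pochhammerRatio]; positivity
    refine squeeze_zero (fun n => mul_nonneg (hc n) (hJ0 n)) (fun n => ?_) hz
    rw [mul_assoc]
    exact mul_le_mul_of_nonneg_left (hJle n) (hc n)
  have hhs := ((hasSum_ordinaryHypergeometric_one hb (by positivity : 0 < a + 1)
    habs).mul_left (T ^ a / (a * (s + T) ^ (m + 1)))).tendsto_sum_nat.add hlim
  have h0 : J 0 = ∫ t in 0..T, t ^ (a - 1) * ((t + s) ^ (m + 1))⁻¹ := by simp [hJ]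
  rw [← h0, ← add_zero (_ * _)]
  refine tendsto_nhds_unique ?_ hhs
  exact tendsto_const_nhds.congr hsum

/-! ### Radial integrals inside and outside the line-of-sight disc -/

/-- Telescoping of consecutive negative powers of `1 + x`; the origin of the sums over `m < N_j` in
`Ξ`. -/
lemma one_sub_inv_one_add_pow {x : ℝ} (hx : 0 ≤ x) (n : ℕ) :
    1 - ((1 + x) ^ n)⁻¹ = ∑ m ∈ Finset.range n, x * ((1 + x) ^ (m + 1))⁻¹ := by
  induction n with
  | zero => simp
  | succ n ih =>
    rw [Finset.sum_range_succ, ← ih]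
    have : 0 < 1 + x := by positivity
    field_simp
    ring

/-- The substitution `y = r ^ p` in an integral `∫ r F(r ^ p) dr`. -/
lemma integral_mul_comp_rpow {p B : ℝ} (hp : p ≠ 0) {F : ℝ → ℝ}
    (hF : IntegrableOn (fun y => |p|⁻¹ * y ^ (2 / p - 1) * F y) (Ioc 0 B)) :
    IntegrableOn (fun r => r * F (r ^ p)) (Ioi 0 ∩ {r | r ^ p ≤ B}) ∧
      ∫ r in Ioi 0 ∩ {r | r ^ p ≤ B}, r * F (r ^ p)
        = ∫ y in Ioc 0 B, |p|⁻¹ * y ^ (2 / p - 1) * F y := by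
  set g : ℝ → ℝ := (Iic B).indicator fun y => |p|⁻¹ * y ^ (2 / p - 1) * F y with hg
  have hmeas : MeasurableSet {r : ℝ | r ^ p ≤ B} :=
    measurableSet_le (by fun_prop) measurable_const
  have heq : EqOn (fun x => (|p| * x ^ (p - 1)) • g (x ^ p))
      ({r | r ^ p ≤ B}.indicator fun r => r * F (r ^ p)) (Ioi 0) := by
    intro r hr
    have hr : 0 < r := hr
    by_cases h : r ^ p ≤ B
    · have h1 : g (r ^ p) = |p|⁻¹ * (r ^ p) ^ (2 / p - 1) * F (r ^ p) := by
        rw [hg, Set.indicator_of_mem (by exact h)]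
      have h2 : r ^ (p - 1) * (r ^ p) ^ (2 / p - 1) = r := by
        rw [← Real.rpow_mul hr.le, ← Real.rpow_add hr]
        have : p - 1 + p * (2 / p - 1) = 1 := by field_simp; ring
        rw [this, Real.rpow_one]
      have h3 : |p| ≠ 0 := abs_ne_zero.2 hp
      simp only [smul_eq_mul]
      rw [Set.indicator_of_mem (by exact h), h1]
      calc _ = (|p| * |p|⁻¹) * (r ^ (p - 1) * (r ^ p) ^ (2 / p - 1)) * F (r ^ p) := by ring
        _ = _ := by rw [h2, mul_inv_cancel₀ h3, one_mul]
    · have h1 : g (r ^ p) = 0 := by rw [hg, Set.indicator_of_notMem (by exact h)]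
      simp only [smul_eq_mul]
      rw [Set.indicator_of_notMem (by exact h), h1, mul_zero]
  have hgi : IntegrableOn g (Ioi 0) := by
    rw [hg, IntegrableOn, integrable_indicator_iff measurableSet_Iic, IntegrableOn,
      Measure.restrict_restrict measurableSet_Iic, inter_comm, Ioi_inter_Iic]
    exact hF
  constructor
  · have := (integrableOn_Ioi_comp_rpow_iff g hp).2 hgi
    rw [integrableOn_congr_fun heq measurableSet_Ioi, IntegrableOn,
      integrable_indicator_iff hmeas, IntegrableOn, Measure.restrict_restrict hmeas,
      inter_comm] at this
    exact this
  · have := integral_comp_rpow_Ioi g hp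
    rw [setIntegral_congr_fun measurableSet_Ioi heq, setIntegral_indicator hmeas, hg,
      setIntegral_indicator measurableSet_Iic, Ioi_inter_Iic] at this
    exact this

/-- Serves both zones: `{r ^ p ≤ B}` is a bounded interval of radii for `p = α` and an unbounded one
for `p = -α`. -/
lemma integral_mul_comp_rpow_of_eq_sum {p B S : ℝ} (hp : p ≠ 0) (hB : 0 < B) (hS : 0 < S) {N : ℕ}
    {F : ℝ → ℝ} {c a : ℕ → ℝ} (ha : ∀ m, 0 < a m)
    (hF : ∀ y ∈ Ioc 0 B, |p|⁻¹ * y ^ (2 / p - 1) * F y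
      = ∑ m ∈ Finset.range N, c m * (y ^ (a m - 1) * ((y + S) ^ (m + 1))⁻¹)) :
    IntegrableOn (fun r => r * F (r ^ p)) (Ioi 0 ∩ {r | r ^ p ≤ B}) ∧
      ∫ r in Ioi 0 ∩ {r | r ^ p ≤ B}, r * F (r ^ p)
        = ∑ m ∈ Finset.range N, c m * (B ^ a m / (a m * (S + B) ^ (m + 1)) *
            ordinaryHypergeometric (1 : ℝ) ((m : ℝ) + 1) (a m + 1) (B / (B + S))) := by
  have hi (m : ℕ) : IntegrableOn (fun y => c m * (y ^ (a m - 1) * ((y + S) ^ (m + 1))⁻¹))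
      (Ioc 0 B) :=
    (intervalIntegrable_iff_integrableOn_Ioc_of_le hB.le).1
      ((intervalIntegrable_rpow_div (ha m) hS hB.le (m + 1)).const_mul (c m))
  have hint : IntegrableOn (fun y => |p|⁻¹ * y ^ (2 / p - 1) * F y) (Ioc 0 B) := by
    rw [integrableOn_congr_fun hF measurableSet_Ioc]
    exact integrable_finsetSum _ fun m _ => hi m
  obtain ⟨h1, h2⟩ := integral_mul_comp_rpow hp hint
  refine ⟨h1, ?_⟩
  rw [h2, setIntegral_congr_fun measurableSet_Ioc hF, integral_finsetSum _ fun m _ => hi m]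
  refine Finset.sum_congr rfl fun m _ => ?_
  rw [← integral_rpow_div_eq_hypergeometric (ha m) hS hB, integral_const_mul,
    intervalIntegral.integral_of_le hB.le]

/-- With `y = r ^ α` and `x = s w / y`, `x (1 + x) ^ (-(m + 1)) = s w y ^ m (y + s w) ^ (-(m + 1))`.
With the Jacobian `y ^ (2 / α - 1) / α` this gives the Euler exponent `m + 2 / α`, positive for
every `α > 0`. -/
lemma integral_near {α w s D : ℝ} (hα : 0 < α) (hw : 0 < w) (hs : 0 < s) (hD : 0 < D) (N : ℕ) :
    IntegrableOn (fun r => r * (1 - ((1 + s * (w * r ^ (-α))) ^ N)⁻¹)) (Ioc 0 D) ∧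
      ∫ r in Ioc 0 D, r * (1 - ((1 + s * (w * r ^ (-α))) ^ N)⁻¹)
        = s * ((w ^ (2 / α) / α) * ∑ m ∈ Finset.range N,
            (D ^ α / w) ^ ((m : ℝ) + 2 / α) /
                (((m : ℝ) + 2 / α) * (s + D ^ α / w) ^ (m + 1)) *
              ordinaryHypergeometric (1 : ℝ) ((m : ℝ) + 1) ((m : ℝ) + 2 / α + 1)
                ((D ^ α / w) / (D ^ α / w + s))) := by
  have hB : 0 < D ^ α := Real.rpow_pos_of_pos hD _
  have hset : Ioi 0 ∩ {r : ℝ | r ^ α ≤ D ^ α} = Ioc 0 D := by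
    ext r
    simp only [mem_inter_iff, mem_Ioi, mem_ofPred_eq, mem_Ioc]
    exact and_congr_right fun hr => Real.rpow_le_rpow_iff hr.le hD.le hα
  have key := integral_mul_comp_rpow_of_eq_sum (p := α) (B := D ^ α) (S := s * w) (N := N) hα.ne' hB
    (by positivity) (F := fun y => 1 - ((1 + s * (w * y⁻¹)) ^ N)⁻¹) (c := fun _ => s * w / α)
    (a := fun m => (m : ℝ) + 2 / α) (fun m => by positivity) (fun y hy => by
      have hy0 : 0 < y := hy.1
      rw [one_sub_inv_one_add_pow (by positivity), Finset.mul_sum]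
      refine Finset.sum_congr rfl fun m _ => ?_
      have h1 : y ^ ((m : ℝ) + 2 / α - 1) = y ^ m * y ^ (2 / α - 1) := by
        rw [← Real.rpow_natCast, ← Real.rpow_add hy0, add_sub_assoc]
      have h2 : 1 + s * (w * y⁻¹) = (y + s * w) / y := by field_simp
      rw [h1, h2, abs_of_pos hα, div_pow]
      field_simp
      ring)
  rw [hset] at key
  have hfun : EqOn (fun r => r * (1 - ((1 + s * (w * (r ^ α)⁻¹)) ^ N)⁻¹))
      (fun r => r * (1 - ((1 + s * (w * r ^ (-α))) ^ N)⁻¹)) (Ioc 0 D) := fun r hr => by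
    simp only [Real.rpow_neg hr.1.le]
  refine ⟨(integrableOn_congr_fun hfun measurableSet_Ioc).1 key.1, ?_⟩
  rw [← setIntegral_congr_fun measurableSet_Ioc hfun, key.2, Finset.mul_sum, Finset.mul_sum]
  refine Finset.sum_congr rfl fun m _ => ?_
  have h3 : D ^ α / w / (D ^ α / w + s) = D ^ α / (D ^ α + s * w) := by field_simp
  have h4 : (D ^ α / w) ^ ((m : ℝ) + 2 / α)
      = (D ^ α) ^ ((m : ℝ) + 2 / α) / (w ^ m * w ^ (2 / α)) := by
    rw [Real.div_rpow hB.le hw.le, Real.rpow_add hw, Real.rpow_natCast]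
  have h5 : s + D ^ α / w = (s * w + D ^ α) / w := by field_simp
  have h6 : 0 < w ^ (2 / α) := Real.rpow_pos_of_pos hw _
  have h7 : 0 < (m : ℝ) + 2 / α := by positivity
  rw [h3, h4, h5, div_pow]
  field_simp
  ring

/-- With `y = r ^ (-α)` infinity moves to `0` and `x = s w y`. The Euler exponent is `1 - 2 / α` for
every `m`; its positivity is the condition `α > 2`. -/
lemma integral_far {α w s D : ℝ} (hα : 2 < α) (hw : 0 < w) (hs : 0 < s) (hD : 0 < D) (N : ℕ) :
    IntegrableOn (fun r => r * (1 - ((1 + s * (w * r ^ (-α))) ^ N)⁻¹)) (Ioi D) ∧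
      ∫ r in Ioi D, r * (1 - ((1 + s * (w * r ^ (-α))) ^ N)⁻¹)
        = s * ((w ^ (2 / α) / α) * ∑ m ∈ Finset.range N,
            (D ^ α / w) ^ ((m : ℝ) + 2 / α) /
                ((1 - 2 / α) * (s + D ^ α / w) ^ (m + 1)) *
              ordinaryHypergeometric (1 : ℝ) ((m : ℝ) + 1) (2 - 2 / α)
                (s / (s + D ^ α / w))) := by
  have hα0 : 0 < α := by linarith
  have hB : 0 < D ^ (-α) := Real.rpow_pos_of_pos hD _
  have hδ : 0 < 1 - 2 / α := by rw [sub_pos, div_lt_one hα0]; exact hα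
  have hset : Ioi 0 ∩ {r : ℝ | r ^ (-α) ≤ D ^ (-α)} = Ici D := by
    ext r
    simp only [mem_inter_iff, mem_Ioi, mem_ofPred_eq, mem_Ici]
    constructor
    · rintro ⟨hr, h⟩
      exact (Real.rpow_le_rpow_iff_of_neg hr hD (by linarith)).1 h
    · intro h
      have hr := hD.trans_le h
      exact ⟨hr, (Real.rpow_le_rpow_iff_of_neg hr hD (by linarith)).2 h⟩
  have key := integral_mul_comp_rpow_of_eq_sum (p := -α) (B := D ^ (-α)) (S := (s * w)⁻¹) (N := N)
    (neg_ne_zero.2 hα0.ne') hB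
    (by positivity) (F := fun y => 1 - ((1 + s * (w * y)) ^ N)⁻¹)
    (c := fun m => s * w / α * ((s * w) ^ (m + 1))⁻¹)
    (a := fun _ => 1 - 2 / α) (fun _ => hδ) (fun y hy => by
      have hy0 : 0 < y := hy.1
      rw [one_sub_inv_one_add_pow (by positivity), Finset.mul_sum]
      refine Finset.sum_congr rfl fun m _ => ?_
      have h1 : y ^ (1 - 2 / α - 1) = y ^ (2 / (-α) - 1) * y := by
        nth_rewrite 3 [← Real.rpow_one y]
        rw [← Real.rpow_add hy0]
        congr 1
        field_simp
        ring
      have h2 : 1 + s * (w * y) = (s * w) * (y + (s * w)⁻¹) := by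
        field_simp
        ring
      rw [h1, h2, abs_neg, abs_of_pos hα0, mul_pow]
      field_simp)
  rw [hset] at key
  refine ⟨key.1.mono_set Ioi_subset_Ici_self, ?_⟩
  rw [setIntegral_congr_set Ioi_ae_eq_Ici, key.2, Finset.mul_sum, Finset.mul_sum]
  refine Finset.sum_congr rfl fun m _ => ?_
  -- In terms of `T`, the quotient `B / (B + S)` with `B = D ^ (-α)` and `S = (s w)⁻¹` is `s / (s +
  -- T)`.
  set T := D ^ α / w with hT
  have hDα : 0 < D ^ α := Real.rpow_pos_of_pos hD _
  have hT0 : 0 < T := by positivity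
  have hBT : D ^ (-α) = (w * T)⁻¹ := by rw [Real.rpow_neg hD.le, hT]; field_simp
  have h3 : D ^ (-α) / (D ^ (-α) + (s * w)⁻¹) = s / (s + T) := by rw [hBT]; field_simp
  have h4 : (D ^ (-α)) ^ (1 - 2 / α) = w ^ (2 / α) * w⁻¹ * (T ^ (2 / α) * T⁻¹) := by
    rw [hBT, Real.inv_rpow (by positivity), Real.mul_rpow hw.le hT0.le, Real.rpow_sub hw,
      Real.rpow_sub hT0, Real.rpow_one, Real.rpow_one]
    field_simp
  have h5 : (s * w)⁻¹ + D ^ (-α) = (s + T) / (s * w * T) := by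
    rw [hBT]
    field_simp
    ring
  have h6 : T ^ ((m : ℝ) + 2 / α) = T ^ m * T ^ (2 / α) := by
    rw [Real.rpow_add hT0, Real.rpow_natCast]
  have h7 : 1 - 2 / α + 1 = 2 - 2 / α := by ring
  rw [h3, h4, h5, h6, h7, div_pow, mul_pow (s * w)]
  field_simp
  ring

/-! ### The exponent `Ξ` as an integral over the plane -/

namespace MmWave.Params

variable (p : Params)

lemma linkLaplace_of_le {s r : ℝ} (hr : r ≤ p.D) :
    1 - p.linkLaplace s r = ∑ V, p.lobeProb V * ∑ j, p.q j *
      (1 - ((1 + s * (p.gain V * p.coef j * r ^ (-p.alpha j))) ^ p.shape j)⁻¹) := by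
  have hq : p.q = p.typeProb r := by
    ext j; cases j <;> simp [q, typeProb, losProb, hr]
  have h1 : (1 : ℝ) = ∑ V, p.lobeProb V * ∑ j, p.typeProb r j := by
    simp [p.sum_typeProb, p.sum_lobeProb]
  rw [linkLaplace, hq, h1, ← Finset.sum_sub_distrib]
  refine Finset.sum_congr rfl fun V _ => ?_
  rw [← mul_sub, ← Finset.sum_sub_distrib, p.sum_typeProb]
  simp only [mul_sub, mul_one, pathLoss, mul_assoc, Finset.sum_sub_distrib, mul_one, p.sum_typeProb,
    p.sum_lobeProb]

lemma linkLaplace_of_lt {s r : ℝ} (hr : p.D < r) :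
    1 - p.linkLaplace s r = ∑ V, p.lobeProb V *
      (1 - ((1 + s * (p.gain V * p.coef LinkType.nlos * r ^ (-p.alpha LinkType.nlos))) ^
        p.shape LinkType.nlos)⁻¹) := by
  have h2 (f : LinkType → ℝ) : ∑ j, p.typeProb r j * f j = f LinkType.nlos := by
    change ∑ j ∈ {LinkType.los, LinkType.nlos}, p.typeProb r j * f j = _
    rw [Finset.sum_pair (by decide)]
    simp [typeProb, losProb, not_le.2 hr]
  simp only [linkLaplace, h2, mul_sub, Finset.sum_sub_distrib, mul_one, p.sum_lobeProb, pathLoss,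
    mul_assoc]

lemma integral_radial_near {s : ℝ} (hs : 0 < s) :
    IntegrableOn (fun r => r * (1 - p.linkLaplace s r)) (Ioc 0 p.D) ∧
      ∫ r in Ioc 0 p.D, r * (1 - p.linkLaplace s r) = s * ∑ j : LinkType, p.q j *
          ∑ V : Lobe, p.lobeProb V * ((p.gain V * p.coef j) ^ (2 / p.alpha j) / p.alpha j) *
            ∑ m ∈ Finset.range (p.shape j),
              p.edge j V ^ ((m : ℝ) + 2 / p.alpha j) /
                (((m : ℝ) + 2 / p.alpha j) * (s + p.edge j V) ^ (m + 1)) *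
              ordinaryHypergeometric (1 : ℝ) ((m : ℝ) + 1) ((m : ℝ) + 2 / p.alpha j + 1)
                (p.edge j V / (p.edge j V + s)) := by
  have hα (j : LinkType) : 0 < p.alpha j := by
    cases j
    exacts [p.alpha_los_pos, two_pos.trans p.two_lt_alpha_nlos]
  have hn (V : Lobe) (j : LinkType) := integral_near (hα j)
    (mul_pos (p.gain_pos V) (p.coef_pos j)) hs p.D_pos (p.shape j)
  have heq : EqOn (fun r => r * (1 - p.linkLaplace s r)) (fun r => ∑ V, ∑ j,
      (p.lobeProb V * p.q j) * (r * (1 - ((1 + s * (p.gain V * p.coef j * r ^ (-p.alpha j))) ^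
        p.shape j)⁻¹))) (Ioc 0 p.D) := fun r hr => by
    simp only [p.linkLaplace_of_le hr.2, Finset.mul_sum]
    refine Finset.sum_congr rfl fun V _ => Finset.sum_congr rfl fun j _ => by ring
  have hi (V : Lobe) (j : LinkType) := (hn V j).1.const_mul (p.lobeProb V * p.q j)
  constructor
  · rw [integrableOn_congr_fun heq measurableSet_Ioc]
    exact integrable_finsetSum _ fun V _ => integrable_finsetSum _ fun j _ => hi V j
  · rw [setIntegral_congr_fun measurableSet_Ioc heq,
      integral_finsetSum _ fun V _ => integrable_finsetSum _ fun j _ => hi V j]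
    simp_rw [integral_finsetSum _ fun j _ => hi _ j, integral_const_mul, (hn _ _).2]
    rw [Finset.sum_comm, Finset.mul_sum]
    refine Finset.sum_congr rfl fun j _ => ?_
    rw [Finset.mul_sum, Finset.mul_sum]
    refine Finset.sum_congr rfl fun V _ => ?_
    simp only [edge]
    ring

lemma integral_radial_far {s : ℝ} (hs : 0 < s) :
    IntegrableOn (fun r => r * (1 - p.linkLaplace s r)) (Ioi p.D) ∧
      ∫ r in Ioi p.D, r * (1 - p.linkLaplace s r) = s * ∑ V : Lobe, p.lobeProb V *
            ((p.gain V * p.coef LinkType.nlos) ^ (2 / p.alpha LinkType.nlos) /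
              p.alpha LinkType.nlos) *
            ∑ m ∈ Finset.range (p.shape LinkType.nlos),
              p.edge LinkType.nlos V ^ ((m : ℝ) + 2 / p.alpha LinkType.nlos) /
                ((1 - 2 / p.alpha LinkType.nlos) * (s + p.edge LinkType.nlos V) ^ (m + 1)) *
              ordinaryHypergeometric (1 : ℝ) ((m : ℝ) + 1) (2 - 2 / p.alpha LinkType.nlos)
                (s / (s + p.edge LinkType.nlos V)) := by
  have hn (V : Lobe) := integral_far p.two_lt_alpha_nlos
    (mul_pos (p.gain_pos V) (p.coef_pos LinkType.nlos)) hs p.D_pos (p.shape LinkType.nlos)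
  have heq : EqOn (fun r => r * (1 - p.linkLaplace s r)) (fun r => ∑ V,
      p.lobeProb V * (r * (1 - ((1 + s * (p.gain V * p.coef LinkType.nlos *
        r ^ (-p.alpha LinkType.nlos))) ^ p.shape LinkType.nlos)⁻¹))) (Ioi p.D) := fun r hr => by
    simp only [p.linkLaplace_of_lt hr, Finset.mul_sum]
    refine Finset.sum_congr rfl fun V _ => by ring
  have hi (V : Lobe) := (hn V).1.const_mul (p.lobeProb V)
  constructor
  · rw [integrableOn_congr_fun heq measurableSet_Ioi]
    exact integrable_finsetSum _ fun V _ => hi V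
  · rw [setIntegral_congr_fun measurableSet_Ioi heq, integral_finsetSum _ fun V _ => hi V]
    simp_rw [integral_const_mul, (hn _).2]
    rw [Finset.mul_sum]
    refine Finset.sum_congr rfl fun V _ => ?_
    simp only [edge]
    ring

lemma linkLaplace_le_one {s r : ℝ} (hs : 0 ≤ s) (hr : 0 ≤ r) : p.linkLaplace s r ≤ 1 := by
  have h1 : (1 : ℝ) = ∑ V, p.lobeProb V * ∑ j, p.typeProb r j := by
    simp [p.sum_typeProb, p.sum_lobeProb]
  rw [h1, linkLaplace]
  refine Finset.sum_le_sum fun V _ => mul_le_mul_of_nonneg_left (Finset.sum_le_sum fun j _ => ?_)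
    (p.lobeProb_nonneg V)
  exact mul_le_of_le_one_right (p.typeProb_nonneg r j) (p.linkLaplace_inner_le_one hs hr V j)

lemma integrable_one_sub_linkLaplace {s : ℝ} (hs : 0 < s) :
    Integrable fun x : Plane => 1 - p.linkLaplace s ‖x‖ := by
  have hi : IntegrableOn (fun r => r * (1 - p.linkLaplace s r)) (Ioi 0) := by
    rw [← Ioc_union_Ioi_eq_Ioi p.D_pos.le]
    exact (p.integral_radial_near hs).1.union (p.integral_radial_far hs).1
  have hdim : Module.finrank ℝ Plane = 2 := by simp
  rw [integrable_fun_norm_addHaar volume (f := fun r => 1 - p.linkLaplace s r), hdim]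
  simpa using hi

/-- Polar coordinates: `2π` is the dimension times the area of the unit disc. The radial integral is
split at `D`. -/
lemma integral_one_sub_linkLaplace {s : ℝ} (hs : 0 < s) :
    p.lamE * ∫ x : Plane, (1 - p.linkLaplace s ‖x‖) = -p.Xi s := by
  obtain ⟨hi1, he1⟩ := p.integral_radial_near hs
  obtain ⟨hi2, he2⟩ := p.integral_radial_far hs
  have hdim : Module.finrank ℝ Plane = 2 := by simp
  have hball : volume.real (Metric.ball (0 : Plane) 1) = Real.pi := by
    rw [Measure.real, EuclideanSpace.volume_ball]
    simp only [Fintype.card_fin, ENNReal.ofReal_one, one_pow, one_mul, Real.sq_sqrt Real.pi_pos.le,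
      Nat.cast_ofNat, div_self (two_ne_zero' ℝ)]
    rw [one_add_one_eq_two, Real.Gamma_two, div_one, ENNReal.toReal_ofReal Real.pi_pos.le]
  rw [integral_fun_norm_addHaar volume (fun r => 1 - p.linkLaplace s r), hdim, hball]
  simp only [Nat.add_one_sub_one, pow_one, smul_eq_mul, nsmul_eq_mul, Nat.cast_ofNat]
  rw [← Ioc_union_Ioi_eq_Ioi p.D_pos.le,
    setIntegral_union (Ioc_disjoint_Ioi le_rfl) measurableSet_Ioi hi1 hi2, he1, he2, Xi]
  ring

lemma Xi_nonpos {s : ℝ} (hs : 0 < s) : p.Xi s ≤ 0 := by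
  have := p.integral_one_sub_linkLaplace hs
  have h1 : 0 ≤ ∫ x : Plane, (1 - p.linkLaplace s ‖x‖) := integral_nonneg fun x =>
    sub_nonneg.2 (p.linkLaplace_le_one hs.le (norm_nonneg x))
  have := mul_nonneg p.lamE_pos.le h1
  linarith

lemma lintegral_one_sub_linkLaplace {s : ℝ} (hs : 0 < s) :
    ENNReal.ofReal p.lamE * ∫⁻ x : Plane, ENNReal.ofReal (1 - p.linkLaplace s ‖x‖)
      = ENNReal.ofReal (-p.Xi s) := by
  rw [← ofReal_integral_eq_lintegral_ofReal (p.integrable_one_sub_linkLaplace hs)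
    (Eventually.of_forall fun x => sub_nonneg.2 (p.linkLaplace_le_one hs.le (norm_nonneg x))),
    ← ENNReal.ofReal_mul p.lamE_pos.le, p.integral_one_sub_linkLaplace hs]

/-- Read off the integral rather than the closed form: the integrand increases with `s`, so its
value at `s = 1` dominates. -/
lemma tendsto_Xi_zero : Tendsto p.Xi (𝓝[>] 0) (𝓝 0) := by
  have h : Tendsto (fun s => ∫ x : Plane, (1 - p.linkLaplace s ‖x‖)) (𝓝[>] 0)
      (𝓝 (∫ _ : Plane, (0 : ℝ))) := by
    have hpos : ∀ᶠ s : ℝ in 𝓝[>] 0, 0 < s ∧ s < 1 :=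
      Ioo_mem_nhdsGT one_pos
    refine tendsto_integral_filter_of_dominated_convergence
      (fun x : Plane => 1 - p.linkLaplace 1 ‖x‖)
      (hpos.mono fun s hs => (p.integrable_one_sub_linkLaplace hs.1).aestronglyMeasurable)
      (hpos.mono fun s hs => Eventually.of_forall fun x => ?_)
      (p.integrable_one_sub_linkLaplace one_pos) (Eventually.of_forall fun x => ?_)
    · rw [Real.norm_of_nonneg (sub_nonneg.2 (p.linkLaplace_le_one hs.1.le (norm_nonneg x)))]
      refine sub_le_sub_left (Finset.sum_le_sum fun V _ => mul_le_mul_of_nonneg_left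
        (Finset.sum_le_sum fun j _ => mul_le_mul_of_nonneg_left ?_
          (p.typeProb_nonneg _ j)) (p.lobeProb_nonneg V)) 1
      have h1 : 0 ≤ p.gain V * p.pathLoss j ‖x‖ :=
        mul_nonneg (p.gain_pos V).le (p.pathLoss_nonneg j (norm_nonneg x))
      have h2 : 0 ≤ s * (p.gain V * p.pathLoss j ‖x‖) := mul_nonneg hs.1.le h1
      refine inv_anti₀ (by positivity) (pow_le_pow_left₀ (by positivity) ?_ _)
      have := hs.2
      gcongr
    · have hc : ContinuousAt (fun s => 1 - p.linkLaplace s ‖x‖) 0 := by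
        unfold linkLaplace
        refine continuousAt_const.sub (tendsto_finsetSum _ fun V _ => tendsto_const_nhds.mul
          (tendsto_finsetSum _ fun j _ => tendsto_const_nhds.mul (ContinuousAt.inv₀ ?_ (by simp))))
        exact Continuous.continuousAt (by fun_prop)
      have h0 : 1 - p.linkLaplace 0 ‖x‖ = 0 := by
        simp [linkLaplace, p.sum_typeProb, p.sum_lobeProb]
      have := hc.tendsto
      simp only [h0] at this
      exact this.mono_left nhdsWithin_le_nhds
  have h2 := (h.const_mul p.lamE).neg
  simp only [integral_zero, mul_zero, neg_zero] at h2
  refine h2.congr' ?_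
  filter_upwards [self_mem_nhdsWithin] with s hs
  rw [p.integral_one_sub_linkLaplace hs, neg_neg]

end MmWave.Params

/-! ### Derivatives of a Laplace transform -/

section LaplaceTransform

variable {Ω : Type*} [MeasurableSpace Ω] {P : Measure Ω} [IsProbabilityMeasure P]
  {Y : Ω → ℝ} {g : ℝ → ℝ}

/-- `exp (-t Y) ≤ 1` for `t > 0`. Interior points are where the moment generating function of `-Y`
is analytic and may be differentiated under the integral. -/
lemma mem_interior_integrableExpSet_neg (hY : AEMeasurable Y P) (h0 : ∀ᵐ ω ∂P, 0 ≤ Y ω) {s : ℝ}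
    (hs : 0 < s) : s ∈ interior (integrableExpSet (fun ω => -Y ω) P) := by
  refine mem_interior.2 ⟨Ioi 0, fun t ht => ?_, isOpen_Ioi, hs⟩
  refine Integrable.mono' (integrable_const (1 : ℝ)) (by fun_prop) ?_
  filter_upwards [h0] with ω hω
  rw [Real.norm_of_nonneg (Real.exp_pos _).le, Real.exp_le_one_iff]
  have : (0 : ℝ) < t := ht
  nlinarith

omit [IsProbabilityMeasure P] in
lemma mgf_neg_eqOn (hg : ∀ s, 0 < s → ∫ ω, Real.exp (-s * Y ω) ∂P = g s) :
    EqOn (mgf (fun ω => -Y ω) P) g (Ioi 0) := fun s hs => by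
  rw [← hg s hs, mgf]
  simp

lemma contDiffOn_of_laplace (hY : AEMeasurable Y P) (h0 : ∀ᵐ ω ∂P, 0 ≤ Y ω)
    (hg : ∀ s, 0 < s → ∫ ω, Real.exp (-s * Y ω) ∂P = g s) {n : WithTop ℕ∞} :
    ContDiffOn ℝ n g (Ioi 0) := by
  have h : AnalyticOn ℝ (mgf (fun ω => -Y ω) P) (Ioi 0) :=
    analyticOn_mgf.mono fun s hs => mem_interior_integrableExpSet_neg hY h0 hs
  exact (h.contDiffOn (uniqueDiffOn_Ioi 0)).congr fun s hs => (mgf_neg_eqOn hg hs).symm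

lemma integral_pow_mul_exp_of_laplace (hY : AEMeasurable Y P) (h0 : ∀ᵐ ω ∂P, 0 ≤ Y ω)
    (hg : ∀ s, 0 < s → ∫ ω, Real.exp (-s * Y ω) ∂P = g s) {s : ℝ} (hs : 0 < s) (m : ℕ) :
    ∫ ω, Y ω ^ m * Real.exp (-s * Y ω) ∂P = (-1) ^ m * iteratedDeriv m g s := by
  have h1 := iteratedDeriv_mgf (mem_interior_integrableExpSet_neg hY h0 hs) m
  have h2 : mgf (fun ω => -Y ω) P =ᶠ[𝓝 s] g :=
    Filter.eventuallyEq_of_mem (Ioi_mem_nhds hs) (mgf_neg_eqOn hg)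
  rw [← h2.iteratedDeriv_eq m, h1, ← integral_const_mul]
  refine integral_congr_ae (Eventually.of_forall fun ω => ?_)
  simp only [neg_pow (Y ω) m, ← mul_assoc, ← mul_pow]
  simp

/-- The bridge from fading to derivatives: each term of the tail at `s Y` is a multiple of `Y ^ m
exp (-s Y)`. -/
lemma integral_erlangTail_of_laplace (hY : AEMeasurable Y P) (h0 : ∀ᵐ ω ∂P, 0 ≤ Y ω)
    (hg : ∀ s, 0 < s → ∫ ω, Real.exp (-s * Y ω) ∂P = g s) {s : ℝ} (hs : 0 < s) (n : ℕ) :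
    Integrable (fun ω => erlangTail n (s * Y ω)) P ∧
    ∫ ω, erlangTail n (s * Y ω) ∂P
      = ∑ m ∈ Finset.range n, s ^ m / (Nat.factorial m) * (-1) ^ m * iteratedDeriv m g s := by
  have hi (m : ℕ) : Integrable (fun ω => Y ω ^ m * Real.exp (-s * Y ω)) P := by
    have := (integrable_pow_mul_exp_of_mem_interior_integrableExpSet
      (mem_interior_integrableExpSet_neg hY h0 hs) m).const_mul ((-1) ^ m)
    refine this.congr (Eventually.of_forall fun ω => ?_)
    simp only [neg_pow (Y ω) m, ← mul_assoc, ← mul_pow]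
    simp
  have heq (ω : Ω) : erlangTail n (s * Y ω) = ∑ m ∈ Finset.range n,
      s ^ m / (Nat.factorial m) * (Y ω ^ m * Real.exp (-s * Y ω)) := by
    rw [erlangTail, Finset.mul_sum]
    refine Finset.sum_congr rfl fun m _ => ?_
    rw [mul_pow, neg_mul]
    ring
  simp_rw [heq]
  refine ⟨integrable_finsetSum _ fun m _ => (hi m).const_mul _, ?_⟩
  rw [integral_finsetSum _ fun m _ => (hi m).const_mul _]
  refine Finset.sum_congr rfl fun m _ => ?_
  rw [integral_const_mul, integral_pow_mul_exp_of_laplace hY h0 hg hs, mul_assoc]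

end LaplaceTransform

/-! ### Aggregate signal of a fixed base station -/

namespace MmWave

/-- The marks (blockage, fading) of a link. -/
abbrev Mark : Type := ℝ × (LinkType → ℝ)

/-- The marks (angle, (blockage, fading)) of a link towards an eavesdropper. -/
abbrev EveMark : Type := ℝ × Mark

namespace Params

variable (p : Params)

/-- The aggregate signal of a base station of index `i` at `x`, as a function of the locations
and the link marks of the eavesdroppers. -/
noncomputable def aggregate (i : ℕ) (x : Plane) (z : (ℕ → Plane) × (ℕ × ℕ → EveMark)) : ℝ≥0∞ :=
  ∑' n, ENNReal.ofReal (p.signal (dist x (z.1 n)) (z.2 (i, n)))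

lemma measurable_aggregate (i : ℕ) : Measurable (Function.uncurry (p.aggregate i)) := by
  refine Measurable.tsum fun n => Measurable.ennreal_ofReal ?_
  exact p.measurable_signal.comp (by fun_prop : Measurable fun
    a : Plane × (ℕ → Plane) × (ℕ × ℕ → EveMark) => (dist a.1 (a.2.1 n), a.2.2 (i, n)))

lemma measurable_linkLaplace (s : ℝ) : Measurable (p.linkLaplace s) := by
  have h1 (j : LinkType) : Measurable fun r => p.typeProb r j := by
    cases j
    exacts [p.measurable_losProb, measurable_const.sub p.measurable_losProb]
  have h2 := p.measurable_pathLoss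
  unfold linkLaplace
  fun_prop

/-- The conditional secure connection probability given a serving link of type `j` and
length `r`. -/
noncomputable def condTau (j : LinkType) (r : ℝ) : ℝ :=
  ∑ m ∈ Finset.range (p.shape j),
    p.arg j r ^ m / (Nat.factorial m) * (-1) ^ m * iteratedDeriv m p.expXi (p.arg j r)

variable {Ω : Type*} [MeasurableSpace Ω] {P : Measure Ω} [IsProbabilityMeasure P]

/-- The law of the locations and the link marks of the eavesdroppers. -/
noncomputable def eveLaw (X : ℕ → Ω → Plane) (P : Measure Ω) :
    Measure ((ℕ → Plane) × (ℕ × ℕ → EveMark)) :=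
  (P.map fun ω n => X n ω).prod (Measure.infinitePi fun _ => p.eveLinkLaw)

variable {X : ℕ → Ω → Plane} (hX : IsPoissonProcess X p.lamE P)
include hX

lemma isProbabilityMeasure_eveLaw : IsProbabilityMeasure (p.eveLaw X P) := by
  have := Measure.isProbabilityMeasure_map (μ := P) (f := fun ω n => X n ω)
    (measurable_pi_lambda _ hX.measurable).aemeasurable
  unfold eveLaw
  infer_instance

/-- Given the locations, the signals are independent, so the conditional transform is a product over
eavesdroppers, that is `expNeg` of a sum of `f` over the Poisson points. The Laplace functional then
averages over the locations. -/
lemma lintegral_expNeg_aggregate (i : ℕ) (x : Plane) {s : ℝ} (hs : 0 < s) :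
    ∫⁻ z, expNeg (ENNReal.ofReal s * p.aggregate i x z) ∂(p.eveLaw X P)
      = ENNReal.ofReal (Real.exp (p.Xi s)) := by
  have hagg := p.measurable_aggregate i
  have hXm : Measurable fun ω n => X n ω := measurable_pi_lambda _ hX.measurable
  have hm : Measurable fun z => expNeg (ENNReal.ofReal s * p.aggregate i x z) :=
    measurable_expNeg.comp (measurable_const.mul hagg.of_uncurry_left)
  set f : Plane → ℝ≥0∞ := fun z => negLog (ENNReal.ofReal (p.linkLaplace s (dist x z))) with hf
  have hfm : Measurable f := measurable_negLog.comp
    ((p.measurable_linkLaplace s).comp (by fun_prop)).ennreal_ofReal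
  have hinner (e : ℕ → Plane) : ∫⁻ m, expNeg (ENNReal.ofReal s * p.aggregate i x (e, m))
      ∂(Measure.infinitePi fun _ : ℕ × ℕ => p.eveLinkLaw) = expNeg (∑' n, f (e n)) := by
    simp only [aggregate, ← ENNReal.tsum_mul_left]
    have hsig (n : ℕ) : Measurable fun k : EveMark =>
        ENNReal.ofReal s * ENNReal.ofReal (p.signal (dist x (e n)) k) :=
      measurable_const.mul p.measurable_signal.of_uncurry_left.ennreal_ofReal
    have hind : iIndepFun (fun n (m : ℕ × ℕ → EveMark) =>
        ENNReal.ofReal s * ENNReal.ofReal (p.signal (dist x (e n)) (m (i, n))))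
        (Measure.infinitePi fun _ => p.eveLinkLaw) :=
      ((iIndepFun_infinitePi (P := fun _ : ℕ × ℕ => p.eveLinkLaw) (X := fun _ k => k)
        fun _ => measurable_id).precomp (g := fun n => (i, n))
          (Prod.mk_right_injective i)).comp _ hsig
    have hZ (n : ℕ) : Measurable fun m : ℕ × ℕ → EveMark =>
        ENNReal.ofReal s * ENNReal.ofReal (p.signal (dist x (e n)) (m (i, n))) :=
      (hsig n).comp (measurable_pi_apply (i, n))
    rw [lintegral_expNeg_tsum hZ hind]
    congr 1
    refine tsum_congr fun n => ?_
    rw [hf]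
    simp only
    rw [← p.lintegral_expNeg_signal hs.le dist_nonneg]
    congr 1
    exact (measurePreserving_eval_infinitePi (fun _ : ℕ × ℕ => p.eveLinkLaw) (i, n)).lintegral_comp
      (measurable_expNeg.comp (hsig n))
  rw [eveLaw, lintegral_prod _ hm.aemeasurable]
  simp_rw [hinner]
  have hsum : Measurable fun e : ℕ → Plane => expNeg (∑' n, f (e n)) :=
    measurable_expNeg.comp (Measurable.tsum fun n => hfm.comp (measurable_pi_apply n))
  rw [lintegral_map hsum hXm, hX.lintegral_expNeg_tsum p.lamE_pos.le hfm]
  have h1 (z : Plane) : 1 - expNeg (f z) = ENNReal.ofReal (1 - p.linkLaplace s ‖z - x‖) := by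
    have h0 := p.linkLaplace_nonneg hs.le (dist_nonneg (x := x) (y := z))
    rw [hf]
    simp only
    rw [expNeg_negLog (ENNReal.ofReal_le_one.2 (p.linkLaplace_le_one hs.le dist_nonneg)),
      ENNReal.ofReal_sub _ (by rwa [← dist_eq_norm, dist_comm]), ENNReal.ofReal_one,
      dist_comm, dist_eq_norm]
  simp_rw [h1]
  -- Translation invariance removes the position `x` of the station.
  rw [lintegral_sub_right_eq_self (fun z : Plane => ENNReal.ofReal (1 - p.linkLaplace s ‖z‖)) x,
    p.lintegral_one_sub_linkLaplace hs, expNeg_ofReal (neg_nonneg.2 (p.Xi_nonpos hs)), neg_neg]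

/-- As `s → 0+`, the transform tends both to the probability of finiteness and to `exp 0 = 1`. The
mean is no substitute: a path loss with exponent at least `2` is not integrable near the station. -/
lemma aggregate_lt_top (i : ℕ) (x : Plane) : ∀ᵐ z ∂(p.eveLaw X P), p.aggregate i x z < ∞ := by
  have := p.isProbabilityMeasure_eveLaw hX
  have hagg : Measurable (p.aggregate i x) := (p.measurable_aggregate i).of_uncurry_left
  have hseq : Tendsto (fun n : ℕ => 1 / ((n : ℝ) + 1)) atTop (𝓝[>] 0) :=
    tendsto_nhdsWithin_iff.2 ⟨tendsto_one_div_add_atTop_nhds_zero_nat,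
      Eventually.of_forall fun n => by simp only [mem_Ioi]; positivity⟩
  have h1 : Tendsto (fun n : ℕ => ∫⁻ z, expNeg (ENNReal.ofReal (1 / ((n : ℝ) + 1)) *
      p.aggregate i x z) ∂(p.eveLaw X P)) atTop (𝓝 1) := by
    have h2 : Tendsto (fun n : ℕ => ENNReal.ofReal (Real.exp (p.Xi (1 / ((n : ℝ) + 1))))) atTop
        (𝓝 (ENNReal.ofReal (Real.exp 0))) :=
      ENNReal.tendsto_ofReal ((Real.continuous_exp.tendsto 0).comp (p.tendsto_Xi_zero.comp hseq))
    rw [Real.exp_zero, ENNReal.ofReal_one] at h2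
    exact h2.congr fun n => (p.lintegral_expNeg_aggregate hX i x (by positivity)).symm
  -- The infimum over the proposition is `0` where the aggregate is finite and `∞` elsewhere: the
  -- pointwise limit of the aggregate divided by `n + 1`.
  have h3 : Tendsto (fun n : ℕ => ∫⁻ z, expNeg (ENNReal.ofReal (1 / ((n : ℝ) + 1)) *
      p.aggregate i x z) ∂(p.eveLaw X P)) atTop
      (𝓝 (∫⁻ z, expNeg (⨅ _ : p.aggregate i x z < ∞, 0) ∂(p.eveLaw X P))) := by
    refine tendsto_expNeg_tsum (fun n => (measurable_const.mul hagg).aemeasurable) fun z => ?_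
    by_cases hz : p.aggregate i x z < ∞
    · simp only [hz, iInf_pos]
      have h4 : Tendsto (fun n : ℕ => ENNReal.ofReal (1 / ((n : ℝ) + 1))) atTop (𝓝 0) := by
        simpa using ENNReal.tendsto_ofReal (hseq.mono_right nhdsWithin_le_nhds)
      simpa using ENNReal.Tendsto.mul_const h4 (Or.inr hz.ne)
    · simp only [hz, iInf_neg, not_false_eq_true]
      have hz' : p.aggregate i x z = ∞ := by simpa using hz
      refine tendsto_const_nhds.congr fun n => ?_
      rw [hz', ENNReal.mul_top]
      have : 0 < 1 / ((n : ℝ) + 1) := by positivity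
      simpa using this
  have h5 := tendsto_nhds_unique h3 h1
  have hset : MeasurableSet {z | p.aggregate i x z < ∞} := measurableSet_lt hagg measurable_const
  have h6 : ∫⁻ z, expNeg (⨅ _ : p.aggregate i x z < ∞, 0) ∂(p.eveLaw X P)
      = p.eveLaw X P {z | p.aggregate i x z < ∞} := by
    rw [← lintegral_indicator_one hset]
    refine lintegral_congr fun z => ?_
    by_cases hz : p.aggregate i x z < ∞ <;> simp [hz, Set.indicator]
  rw [h6] at h5
  exact (prob_compl_eq_zero_iff hset).2 h5

lemma laplace_aggregate (i : ℕ) (x : Plane) {s : ℝ} (hs : 0 < s) :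
    ∫ z, Real.exp (-s * (p.aggregate i x z).toReal) ∂(p.eveLaw X P) = p.expXi s := by
  have hagg : Measurable (p.aggregate i x) := (p.measurable_aggregate i).of_uncurry_left
  rw [integral_eq_lintegral_of_nonneg_ae (Eventually.of_forall fun z => (Real.exp_pos _).le)
    (Real.measurable_exp.comp (hagg.ennreal_toReal.const_mul _)).aestronglyMeasurable, expXi, ← ENNReal.toReal_ofReal (Real.exp_pos (p.Xi s)).le,
    ← p.lintegral_expNeg_aggregate hX i x hs]
  congr 1
  refine lintegral_congr_ae ?_
  filter_upwards [p.aggregate_lt_top hX i x] with z hz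
  rw [expNeg_eq_ofReal (ENNReal.mul_ne_top ENNReal.ofReal_ne_top hz.ne), ENNReal.toReal_mul,
    ENNReal.toReal_ofReal hs.le, neg_mul]

/-- The smoothness of the Laplace transform of the aggregate signal. -/
lemma contDiffOn_expXi : ContDiffOn ℝ (⊤ : ℕ∞) p.expXi (Ioi 0) := by
  have := p.isProbabilityMeasure_eveLaw hX
  exact contDiffOn_of_laplace (P := p.eveLaw X P)
    (p.measurable_aggregate 0).of_uncurry_left.ennreal_toReal.aemeasurable
    (Eventually.of_forall fun z => ENNReal.toReal_nonneg)
    (fun s hs => p.laplace_aggregate hX 0 0 hs)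

lemma lintegral_erlangTail_aggregate (i : ℕ) (x : Plane) {s : ℝ} (hs : 0 < s) (n : ℕ) :
    ∫⁻ z, ENNReal.ofReal (erlangTail n (s * (p.aggregate i x z).toReal)) ∂(p.eveLaw X P)
      = ENNReal.ofReal (∑ m ∈ Finset.range n,
          s ^ m / (Nat.factorial m) * (-1) ^ m * iteratedDeriv m p.expXi s) ∧
    0 ≤ ∑ m ∈ Finset.range n,
          s ^ m / (Nat.factorial m) * (-1) ^ m * iteratedDeriv m p.expXi s := by
  have := p.isProbabilityMeasure_eveLaw hX
  obtain ⟨h1, h2⟩ := integral_erlangTail_of_laplace (P := p.eveLaw X P)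
    (p.measurable_aggregate i).of_uncurry_left.ennreal_toReal.aemeasurable
    (Eventually.of_forall fun z => ENNReal.toReal_nonneg)
    (fun s hs => p.laplace_aggregate hX i x hs) hs n
  have h3 (z) : 0 ≤ erlangTail n (s * (p.aggregate i x z).toReal) := by
    unfold erlangTail
    positivity
  rw [← h2]
  exact ⟨(ofReal_integral_eq_lintegral_ofReal h1 (Eventually.of_forall h3)).symm,
    integral_nonneg h3⟩

end Params

end MmWave

/-! ### Joint law of the network as a product -/

/-- A countable family of independent pairs with independent components splits into two
independent families. -/
lemma infinitePi_prod {ι α β : Type*} [MeasurableSpace α] [MeasurableSpace β]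
    (κ : Measure α) (γ : Measure β) [IsProbabilityMeasure κ] [IsProbabilityMeasure γ] :
    Measure.infinitePi (fun _ : ι => κ.prod γ)
      = ((Measure.infinitePi fun _ : ι => κ).prod (Measure.infinitePi fun _ : ι => γ)).map
        (fun z i => (z.1 i, z.2 i)) := by
  have hm : Measurable fun (z : (ι → α) × (ι → β)) i => (z.1 i, z.2 i) := by fun_prop
  refine (Measure.eq_infinitePi _ fun s t ht => ?_).symm
  have hst : MeasurableSet ((s : Set ι).pi t) :=
    MeasurableSet.pi s.countable_toSet fun i _ => ht i
  rw [Measure.map_apply hm hst, Measure.prod_apply (hm hst)]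
  have h1 (a : ι → α) : Measure.infinitePi (fun _ : ι => γ) (Prod.mk a ⁻¹'
      ((fun (z : (ι → α) × (ι → β)) i => (z.1 i, z.2 i)) ⁻¹' (s : Set ι).pi t))
      = ∏ i ∈ s, γ (Prod.mk (a i) ⁻¹' t i) := by
    rw [← Measure.infinitePi_pi (fun _ : ι => γ)
      fun i _ => measurable_prodMk_left (ht i)]
    rfl
  simp_rw [h1]
  have hg (i : ι) : Measurable fun x => γ (Prod.mk x ⁻¹' t i) := measurable_measure_prodMk_left (ht i)
  rw [lintegral_prod_eq_prod_lintegral_of_indepFun s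
    (fun i (a : ι → α) => γ (Prod.mk (a i) ⁻¹' t i)) (iIndepFun_infinitePi hg)
    fun i => (hg i).comp (measurable_pi_apply i)]
  refine Finset.prod_congr rfl fun i _ => ?_
  rw [Measure.prod_apply (ht i)]
  exact (measurePreserving_eval_infinitePi (fun _ : ι => κ) i).lintegral_comp (hg i)

namespace MmWave

variable {Ω : Type*} [MeasurableSpace Ω]

/-- The law of the blockage variables of the links towards the typical user. -/
noncomputable def blockageLaw : Measure (ℕ → ℝ) :=
  Measure.infinitePi fun _ => ProbabilityTheory.cond volume (Icc (0 : ℝ) 1)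

/-- The law of the channel gains of the links towards the typical user. -/
noncomputable def Params.fadingLaw (p : Params) : Measure (ℕ → LinkType → ℝ) :=
  Measure.infinitePi fun _ => Measure.pi fun j => gammaMeasure (p.shape j) 1

instance : IsProbabilityMeasure blockageLaw := by unfold blockageLaw; infer_instance

instance (p : Params) : IsProbabilityMeasure p.fadingLaw := by
  unfold Params.fadingLaw; infer_instance

/-- The locations of the base stations, the locations and link marks of the eavesdroppers, and
the marks of the links towards the typical user. -/
abbrev Sample : Type :=
  (ℕ → Plane) × ((ℕ → Plane) × (ℕ × ℕ → EveMark)) × (ℕ → Mark)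

namespace Network

variable {p : Params} {P : Measure Ω} (W : Network p P)

/-- The randomness of the network, collected in one random element. -/
def sample (ω : Ω) : Sample :=
  (fun i => W.bs i ω, (fun n => W.eve n ω, fun k => W.eveMark k ω), fun i => W.userMark i ω)

lemma measurable_bs : Measurable fun ω i => W.bs i ω :=
  measurable_pi_lambda _ W.bs_poisson.measurable

lemma measurable_eve : Measurable fun ω n => W.eve n ω :=
  measurable_pi_lambda _ W.eve_poisson.measurable

lemma aemeasurable_userMark : AEMeasurable (fun ω i => W.userMark i ω) P :=
  aemeasurable_pi_iff.2 fun i => (W.userMark_law i).aemeasurable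

lemma aemeasurable_eveMark : AEMeasurable (fun ω k => W.eveMark k ω) P :=
  aemeasurable_pi_iff.2 fun k => (W.eveMark_law k).aemeasurable

lemma aemeasurable_sample : AEMeasurable W.sample P :=
  W.measurable_bs.aemeasurable.prodMk
    ((W.measurable_eve.aemeasurable.prodMk W.aemeasurable_eveMark).prodMk W.aemeasurable_userMark)

/-- Blockage is separated from fading because the choice of the serving station uses the former
only. -/
lemma map_userMark : P.map (fun ω i => W.userMark i ω)
    = (blockageLaw.prod p.fadingLaw).map fun z i => (z.1 i, z.2 i) := by
  rw [(W.userMark_indep.hasLaw_infinitePi W.userMark_law W.aemeasurable_userMark).map_eq]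
  exact infinitePi_prod _ _

lemma map_eveMark : P.map (fun ω k => W.eveMark k ω)
    = Measure.infinitePi fun _ : ℕ × ℕ => p.eveLinkLaw :=
  (W.eveMark_indep.hasLaw_infinitePi W.eveMark_law W.aemeasurable_eveMark).map_eq

variable [IsProbabilityMeasure P]

lemma map_joint : P.map (fun ω => ((fun i => W.bs i ω), (fun n => W.eve n ω),
      (fun i => W.userMark i ω), fun k => W.eveMark k ω))
    = (P.map fun ω i => W.bs i ω).prod ((P.map fun ω n => W.eve n ω).prod
      ((P.map fun ω i => W.userMark i ω).prod (P.map fun ω k => W.eveMark k ω))) := by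
  have h1 := W.aemeasurable_userMark
  have h2 := W.aemeasurable_eveMark
  have h3 := W.measurable_eve.aemeasurable (μ := P)
  have h4 := W.measurable_bs.aemeasurable (μ := P)
  rw [W.indep_bs.map_prod_eq_prod_map_map h4 (h3.prodMk (h1.prodMk h2)),
    W.indep_eve.map_prod_eq_prod_map_map h3 (h1.prodMk h2),
    W.indep_marks.map_prod_eq_prod_map_map h1 h2]

/-- Expectations of functionals of the network as iterated integrals. -/
theorem lintegral_sample {F : Sample → ℝ≥0∞} (hF : Measurable F) :
    ∫⁻ ω, F (W.sample ω) ∂P = ∫⁻ b, ∫⁻ v, ∫⁻ z, ∫⁻ g, F (b, z, fun i => (v i, g i))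
      ∂p.fadingLaw ∂(p.eveLaw W.eve P) ∂blockageLaw ∂(P.map fun ω i => W.bs i ω) := by
  have h1 := W.aemeasurable_userMark
  have h2 := W.aemeasurable_eveMark
  have h3 := W.measurable_eve.aemeasurable (μ := P)
  have h4 := W.measurable_bs.aemeasurable (μ := P)
  have := Measure.isProbabilityMeasure_map h1
  have := Measure.isProbabilityMeasure_map h2
  have := Measure.isProbabilityMeasure_map h3
  have := Measure.isProbabilityMeasure_map h4
  have hmap := lintegral_map' (μ := P) (f := fun y : (ℕ → Plane) × (ℕ → Plane) × (ℕ → Mark) ×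
      (ℕ × ℕ → EveMark) => F (y.1, (y.2.1, y.2.2.2), y.2.2.1))
    (g := fun ω => ((fun i => W.bs i ω), (fun n => W.eve n ω),
      (fun i => W.userMark i ω), fun k => W.eveMark k ω)) (by fun_prop)
    (h4.prodMk (h3.prodMk (h1.prodMk h2)))
  refine hmap.symm.trans ?_
  rw [W.map_joint, lintegral_prod _ (by fun_prop)]
  refine lintegral_congr fun b => ?_
  rw [lintegral_prod _ (by fun_prop)]
  simp only
  have hinner (e : ℕ → Plane) : ∫⁻ y, F (b, (e, y.2), y.1)
        ∂((P.map fun ω i => W.userMark i ω).prod (P.map fun ω k => W.eveMark k ω))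
      = ∫⁻ v, ∫⁻ m, ∫⁻ g, F (b, (e, m), fun i => (v i, g i)) ∂p.fadingLaw
        ∂(Measure.infinitePi fun _ : ℕ × ℕ => p.eveLinkLaw) ∂blockageLaw := by
    rw [lintegral_prod _ (by fun_prop), W.map_eveMark, W.map_userMark,
      lintegral_map (by fun_prop) (by fun_prop), lintegral_prod _ (by fun_prop)]
    refine lintegral_congr fun v => ?_
    -- Fading is moved innermost, so that it can be integrated with the eavesdroppers fixed as well.
    rw [lintegral_lintegral_swap (by fun_prop)]
  simp_rw [hinner]
  rw [lintegral_lintegral_swap (by fun_prop)]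
  refine lintegral_congr fun v => ?_
  rw [Params.eveLaw, lintegral_prod _ (by fun_prop)]

end Network

end MmWave

/-! ### Serving station and conditional connection probability -/

lemma erlangTail_le_one (n : ℕ) {x : ℝ} (hx : 0 ≤ x) : erlangTail n x ≤ 1 := by
  rw [erlangTail, Real.exp_neg, inv_mul_le_iff₀ (Real.exp_pos x), mul_one]
  exact Real.sum_le_exp_of_nonneg hx n

lemma measurable_comp_nat {α β : Type*} [MeasurableSpace α] [MeasurableSpace β] {S : α → ℕ}
    (hS : Measurable S) {H : ℕ → α → β} (hH : ∀ i, Measurable (H i)) :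
    Measurable fun a => H (S a) a :=
  (measurable_from_prod_countable_right (f := Function.uncurry H) hH).comp
    (hS.prodMk measurable_id)

lemma measurable_sInf_nat {α : Type*} [MeasurableSpace α] {q : ℕ → α → Prop}
    (hq : ∀ i, MeasurableSet {a | q i a}) : Measurable fun a => sInf {i | q i a} := by
  refine measurable_of_Iic fun n => ?_
  -- `sInf ∅ = 0`, so every sublevel set also contains the event that no index qualifies.
  have : (fun a => sInf {i | q i a}) ⁻¹' Iic n
      = (⋃ i ∈ Iic n, {a | q i a}) ∪ ⋂ i, {a | q i a}ᶜ := by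
    ext a
    simp only [mem_preimage, mem_Iic, mem_union, mem_iUnion, mem_iInter, mem_compl_iff,
      exists_prop]
    constructor
    · intro h
      rcases Set.eq_empty_or_nonempty {i | q i a} with he | he
      · exact Or.inr fun i hi => Set.eq_empty_iff_forall_notMem.1 he i hi
      · exact Or.inl ⟨_, h, Nat.sInf_mem he⟩
    · rintro (⟨i, hi, hqi⟩ | h)
      · exact (Nat.sInf_le hqi).trans hi
      · have he : {i | q i a} = ∅ := Set.eq_empty_iff_forall_notMem.2 fun i hi => h i hi
        simp [he]
  rw [this]
  exact (MeasurableSet.biUnion (Set.to_countable _) fun i _ => hq i).union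
    (MeasurableSet.iInter fun i => (hq i).compl)

namespace MmWave

namespace Params

variable (p : Params)

lemma measurable_comp_linkType {α β : Type*} [MeasurableSpace α] [MeasurableSpace β]
    {v r : α → ℝ} (hv : Measurable v) (hr : Measurable r) {H : LinkType → α → β}
    (hH : ∀ j, Measurable (H j)) : Measurable fun a => H (p.linkType (v a) (r a)) a := by
  have : (fun a => H (p.linkType (v a) (r a)) a)
      = fun a => if v a < p.losProb (r a) then H LinkType.los a else H LinkType.nlos a := by
    ext a
    unfold linkType
    split_ifs <;> rfl
  rw [this]
  exact Measurable.ite (measurableSet_lt hv (p.measurable_losProb.comp hr)) (hH _) (hH _)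

/-- The index of the serving base station, as a function of the locations of the base stations
and of the blockage variables. -/
noncomputable def servingIndex (b : ℕ → Plane) (v : ℕ → ℝ) : ℕ :=
  sInf {i | ∀ k, p.pathLoss (p.linkType (v k) ‖b k‖) ‖b k‖
    ≤ p.pathLoss (p.linkType (v i) ‖b i‖) ‖b i‖}

/-- The serving index of a sample. -/
noncomputable def sampleIndex (x : Sample) : ℕ := p.servingIndex x.1 fun i => (x.2.2 i).1

/-- The type of the link to the typical user from its serving base station. -/
noncomputable def sampleType (x : Sample) : LinkType :=
  p.linkType (x.2.2 (p.sampleIndex x)).1 ‖x.1 (p.sampleIndex x)‖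

lemma measurable_sampleIndex : Measurable p.sampleIndex := by
  refine measurable_sInf_nat (α := Sample) (q := fun i x => ∀ k,
    p.pathLoss (p.linkType (x.2.2 k).1 ‖x.1 k‖) ‖x.1 k‖
    ≤ p.pathLoss (p.linkType (x.2.2 i).1 ‖x.1 i‖) ‖x.1 i‖) fun i => ?_
  have h (k : ℕ) : Measurable fun x : Sample =>
      p.pathLoss (p.linkType (x.2.2 k).1 ‖x.1 k‖) ‖x.1 k‖ :=
    p.measurable_comp_linkType (H := fun j (x : Sample) => p.pathLoss j ‖x.1 k‖) (by fun_prop)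
      (by fun_prop) fun j => by
        have := p.measurable_pathLoss j
        fun_prop
  have : {x : Sample | ∀ k, p.pathLoss (p.linkType (x.2.2 k).1 ‖x.1 k‖) ‖x.1 k‖
      ≤ p.pathLoss (p.linkType (x.2.2 i).1 ‖x.1 i‖) ‖x.1 i‖}
      = ⋂ k, {x : Sample | p.pathLoss (p.linkType (x.2.2 k).1 ‖x.1 k‖) ‖x.1 k‖
      ≤ p.pathLoss (p.linkType (x.2.2 i).1 ‖x.1 i‖) ‖x.1 i‖} := by ext; simp
  rw [this]
  exact MeasurableSet.iInter fun k => measurableSet_le (h k) (h i)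

lemma measurable_comp_serving {β : Type*} [MeasurableSpace β] {H : ℕ → LinkType → Sample → β}
    (hH : ∀ i j, Measurable (H i j)) :
    Measurable fun x => H (p.sampleIndex x) (p.sampleType x) x :=
  measurable_comp_nat p.measurable_sampleIndex
    (H := fun i x => H i (p.linkType (x.2.2 i).1 ‖x.1 i‖) x) fun i =>
      p.measurable_comp_linkType (by fun_prop) (by fun_prop) (hH i)

lemma gammaMeasure_setOf_one_le_div {n : ℕ} (hn : 0 < n) {a : ℝ} (ha : 0 < a) {I : ℝ≥0∞}
    (hI : I ≠ ∞) :
    gammaMeasure n 1 {h | 1 ≤ ENNReal.ofReal (a * h) / I}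
      = ENNReal.ofReal (erlangTail n (a⁻¹ * I.toReal)) := by
  rw [← gammaMeasure_Ici hn (by positivity)]
  refine measure_congr ?_
  -- At `h = 0` and `I = 0` the quotient is `0 / 0 = 0` and the equivalence fails; the gamma law
  -- gives `(-∞, 0]` no mass.
  have h0 : ∀ᵐ h ∂(gammaMeasure n 1), h ∉ Iic (0 : ℝ) :=
    measure_eq_zero_iff_ae_notMem.1 (gammaMeasure_Iic_zero n 1)
  filter_upwards [h0] with h hh
  have hh : 0 < h := by simpa using hh
  refine propext ?_
  change 1 ≤ ENNReal.ofReal (a * h) / I ↔ a⁻¹ * I.toReal ≤ h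
  have hah : 0 < a * h := by positivity
  rw [inv_mul_le_iff₀ ha, ENNReal.le_div_iff_mul_le (Or.inr (by simpa using hah))
    (Or.inl hI), one_mul, ENNReal.le_ofReal_iff_toReal_le hI hah.le]

lemma inv_gain_mul_pathLoss (j : LinkType) {r : ℝ} (hr : 0 < r) :
    (p.gain Lobe.main * p.pathLoss j r)⁻¹ = p.arg j r := by
  rw [pathLoss, arg, Real.rpow_neg hr.le]
  have := p.gain_pos Lobe.main
  have := p.coef_pos j
  have := Real.rpow_pos_of_pos hr (p.alpha j)
  field_simp

lemma arg_pos (j : LinkType) {r : ℝ} (hr : 0 < r) : 0 < p.arg j r :=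
  div_pos (Real.rpow_pos_of_pos hr _) (mul_pos (p.gain_pos _) (p.coef_pos j))

section

variable {Ω : Type*} [MeasurableSpace Ω] {P : Measure Ω} [IsProbabilityMeasure P]
  {X : ℕ → Ω → Plane} (hX : IsPoissonProcess X p.lamE P)
include hX

lemma condTau_nonneg (j : LinkType) {r : ℝ} (hr : 0 < r) : 0 ≤ p.condTau j r :=
  (p.lintegral_erlangTail_aggregate hX 0 0 (p.arg_pos j hr) (p.shape j)).2

/-- The sum of derivatives is the mean of a tail probability. The bound makes every later integrand
integrable. -/
lemma condTau_le_one (j : LinkType) {r : ℝ} (hr : 0 < r) : p.condTau j r ≤ 1 := by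
  have := p.isProbabilityMeasure_eveLaw hX
  have h := (p.lintegral_erlangTail_aggregate hX 0 0 (p.arg_pos j hr) (p.shape j)).1
  rw [← ENNReal.ofReal_le_one]
  unfold condTau
  rw [← h]
  calc _ ≤ ∫⁻ _, 1 ∂(p.eveLaw X P) := lintegral_mono fun z => ENNReal.ofReal_le_one.2
        (erlangTail_le_one _ (mul_nonneg (p.arg_pos j hr).le ENNReal.toReal_nonneg))
    _ = 1 := by simp

lemma continuousOn_condTau (j : LinkType) : ContinuousOn (p.condTau j) (Ioi 0) := by
  have harg : ContinuousOn (p.arg j) (Ioi 0) := by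
    unfold arg
    exact (continuousOn_id.rpow_const fun r hr => Or.inl (ne_of_gt hr)).div_const _
  refine continuousOn_finsetSum _ fun m _ => ContinuousOn.mul
    (((harg.pow m).div_const _).mul_const _) ?_
  have h1 : ContinuousOn (iteratedDeriv m p.expXi) (Ioi 0) :=
    ((p.contDiffOn_expXi hX).continuousOn_iteratedDerivWithin (m := m)
      (by exact_mod_cast le_top) (uniqueDiffOn_Ioi 0)).congr fun s hs =>
        (iteratedDerivWithin_of_isOpen isOpen_Ioi hs).symm
  exact h1.comp harg fun r hr => p.arg_pos j hr

/-- Regularity of the derivatives of `expXi` is known on `(0, ∞)` only, hence the cut-off. -/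
lemma measurable_indicator_condTau (j : LinkType) :
    Measurable ((Ioi 0).indicator (p.condTau j)) := by
  classical
  rw [← Set.piecewise_eq_indicator]
  exact (p.continuousOn_condTau hX j).measurable_piecewise continuousOn_const measurableSet_Ioi

end

/-- The ratio of the signal received by the typical user to the aggregate signal received by the
eavesdroppers. -/
noncomputable def sampleRatio (x : Sample) : ℝ≥0∞ :=
  ENNReal.ofReal (p.gain Lobe.main *
    p.pathLoss (p.sampleType x) ‖x.1 (p.sampleIndex x)‖ *
      (x.2.2 (p.sampleIndex x)).2 (p.sampleType x)) /
    p.aggregate (p.sampleIndex x) (x.1 (p.sampleIndex x)) x.2.1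

/-- The aggregate signal received by the eavesdroppers in a sample. -/
noncomputable def sampleAggregate (x : Sample) : ℝ≥0∞ :=
  p.aggregate (p.sampleIndex x) (x.1 (p.sampleIndex x)) x.2.1

lemma measurable_sampleAggregate : Measurable p.sampleAggregate := by
  have h (i : ℕ) : Measurable fun x : Sample => p.aggregate i (x.1 i) x.2.1 := by
    have h1 : Measurable fun x : Sample => (x.1 i, x.2.1) := by fun_prop
    have h2 := (p.measurable_aggregate i).comp h1
    exact h2
  have h2 := measurable_comp_nat p.measurable_sampleIndex h
  exact h2

lemma measurable_sampleRatio : Measurable p.sampleRatio := by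
  refine Measurable.div ?_ p.measurable_sampleAggregate
  exact p.measurable_comp_serving (H := fun i j x => ENNReal.ofReal (p.gain Lobe.main *
    p.pathLoss j ‖x.1 i‖ * (x.2.2 i).2 j)) fun i j => by
      have := p.measurable_pathLoss j
      fun_prop

/-- With all else frozen, the serving index and type do not depend on `g`, and a single gamma gain
decides the event. -/
lemma lintegral_fading_ratio {b : ℕ → Plane} (hb : ∀ i, b i ≠ 0) (v : ℕ → ℝ)
    {z : (ℕ → Plane) × (ℕ × ℕ → EveMark)} {i : ℕ} (hi : p.servingIndex b v = i)
    (hz : p.aggregate i (b i) z < ∞) :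
    ∫⁻ g, {x | 1 ≤ p.sampleRatio x}.indicator 1 ((b, z, fun k => (v k, g k)) : Sample)
      ∂p.fadingLaw
      = ENNReal.ofReal (erlangTail (p.shape (p.linkType (v i) ‖b i‖))
          (p.arg (p.linkType (v i) ‖b i‖) ‖b i‖ * (p.aggregate i (b i) z).toReal)) := by
  have hr : 0 < ‖b i‖ := norm_pos_iff.2 (hb i)
  set j := p.linkType (v i) ‖b i‖ with hj
  have ha : 0 < p.gain Lobe.main * p.pathLoss j ‖b i‖ :=
    mul_pos (p.gain_pos _) (p.pathLoss_pos j hr)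
  rw [← p.inv_gain_mul_pathLoss j hr,
    ← gammaMeasure_setOf_one_le_div (p.shape_pos j) ha hz.ne]
  have hset : MeasurableSet {h : ℝ | 1 ≤ ENNReal.ofReal (p.gain Lobe.main * p.pathLoss j ‖b i‖ * h)
      / p.aggregate i (b i) z} :=
    measurableSet_le measurable_const (by fun_prop)
  have hmp := (measurePreserving_eval (fun j => gammaMeasure (p.shape j) 1) j).comp
    (measurePreserving_eval_infinitePi (fun _ : ℕ => Measure.pi fun j =>
      gammaMeasure (p.shape j) 1) i)
  rw [← hmp.measure_preimage hset.nullMeasurableSet,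
    ← lintegral_indicator_one (hmp.measurable hset)]
  refine lintegral_congr fun g => ?_
  have : p.sampleRatio ((b, z, fun k => (v k, g k)) : Sample)
      = ENNReal.ofReal (p.gain Lobe.main * p.pathLoss j ‖b i‖ * g i j)
      / p.aggregate i (b i) z := by
    subst hi
    rfl
  simp only [Set.indicator]
  congr 1
  simp only [mem_ofPred_eq, this]
  rfl

end Params

/-! ### Averaging over the serving station -/

namespace Network

variable {Ω : Type*} [MeasurableSpace Ω] {p : Params} {P : Measure Ω} (W : Network p P)

lemma ae_map_bs_ne_zero [IsProbabilityMeasure P] :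
    ∀ᵐ b ∂(P.map fun ω i => W.bs i ω), ∀ i, b i ≠ 0 := by
  have hset : MeasurableSet {b : ℕ → Plane | ∀ i, b i ≠ 0} := by
    have : {b : ℕ → Plane | ∀ i, b i ≠ 0} = ⋂ i, (fun b => b i) ⁻¹' {0}ᶜ := by ext; simp
    rw [this]
    exact MeasurableSet.iInter fun i =>
      measurable_pi_apply i (measurableSet_singleton (0 : Plane)).compl
  exact (ae_map_iff W.measurable_bs.aemeasurable hset).2 W.bs_poisson.ae_ne_zero

variable [IsProbabilityMeasure P]

/-- A mean that is the same for every fixed station persists at the random serving station, which is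
independent of the eavesdroppers and their marks. -/
lemma lintegral_comp_aggregate {φ : ℝ≥0∞ → ℝ≥0∞} (hφ : Measurable φ) {c : ℝ≥0∞}
    (h : ∀ i x, ∫⁻ z, φ (p.aggregate i x z) ∂(p.eveLaw W.eve P) = c) :
    ∫⁻ ω, φ (W.IE ω) ∂P = c := by
  have := Measure.isProbabilityMeasure_map (W.measurable_bs.aemeasurable (μ := P))
  have h1 := W.lintegral_sample (hφ.comp p.measurable_sampleAggregate)
  refine Eq.trans h1 ?_
  have h2 (b : ℕ → Plane) (v : ℕ → ℝ) : ∫⁻ z, ∫⁻ g, (φ ∘ p.sampleAggregate)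
      (b, z, fun i => (v i, g i)) ∂p.fadingLaw ∂(p.eveLaw W.eve P) = c := by
    rw [← h (p.servingIndex b v) (b (p.servingIndex b v))]
    refine lintegral_congr fun z => ?_
    change ∫⁻ _, φ (p.aggregate (p.servingIndex b v) (b (p.servingIndex b v)) z) ∂p.fadingLaw = _
    simp
  simp_rw [h2]
  simp

omit [IsProbabilityMeasure P] in
lemma aemeasurable_IE : AEMeasurable W.IE P := by
  have h := p.measurable_sampleAggregate.comp_aemeasurable W.aemeasurable_sample
  exact h

theorem IE_lt_top : ∀ᵐ ω ∂P, W.IE ω < ∞ := by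
  have hm : Measurable (({∞} : Set ℝ≥0∞).indicator (1 : ℝ≥0∞ → ℝ≥0∞)) :=
    measurable_one.indicator (measurableSet_singleton _)
  have h := W.lintegral_comp_aggregate hm (c := 0) fun i x => by
    rw [lintegral_eq_zero_iff (f := fun z => ({∞} : Set ℝ≥0∞).indicator 1 (p.aggregate i x z)) (hm.comp (p.measurable_aggregate i).of_uncurry_left)]
    filter_upwards [p.aggregate_lt_top W.eve_poisson i x] with z hz
    simp [hz.ne]
  rw [lintegral_eq_zero_iff' (f := fun ω => ({∞} : Set ℝ≥0∞).indicator 1 (W.IE ω)) (hm.comp_aemeasurable W.aemeasurable_IE)] at h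
  filter_upwards [h] with ω hω
  refine lt_top_iff_ne_top.2 fun ht => ?_
  simp [ht] at hω

theorem laplaceIE_eq {s : ℝ} (hs : 0 < s) : W.laplaceIE s = Real.exp (p.Xi s) := by
  have h := W.lintegral_comp_aggregate (φ := fun y => expNeg (ENNReal.ofReal s * y))
    (by fun_prop) fun i x => p.lintegral_expNeg_aggregate W.eve_poisson i x hs
  rw [laplaceIE, integral_eq_lintegral_of_nonneg_ae
    (Eventually.of_forall fun ω => (Real.exp_pos _).le)
    (Real.measurable_exp.comp_aemeasurable
      (W.aemeasurable_IE.ennreal_toReal.const_mul _)).aestronglyMeasurable,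
    ← ENNReal.toReal_ofReal (Real.exp_pos (p.Xi s)).le, ← h]
  congr 1
  refine lintegral_congr_ae ?_
  filter_upwards [W.IE_lt_top] with ω hω
  rw [expNeg_eq_ofReal (ENNReal.mul_ne_top ENNReal.ofReal_ne_top hω.ne), ENNReal.toReal_mul,
    ENNReal.toReal_ofReal hs.le, neg_mul]

/-- The conditional secure connection probability given the serving base station. -/
noncomputable def servingTau (ω : Ω) : ℝ :=
  (Ioi 0).indicator (p.condTau (W.servingType ω)) (W.servingDist ω)

include W in
lemma measurable_sampleTau : Measurable fun x : Sample =>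
    (Ioi 0).indicator (p.condTau (p.sampleType x)) ‖x.1 (p.sampleIndex x)‖ :=
  p.measurable_comp_serving (H := fun i j x => (Ioi 0).indicator (p.condTau j) ‖x.1 i‖)
    fun i j => (p.measurable_indicator_condTau W.eve_poisson j).comp (by fun_prop)

lemma aemeasurable_servingTau : AEMeasurable W.servingTau P := by
  have h := W.measurable_sampleTau.comp_aemeasurable W.aemeasurable_sample
  exact h

lemma servingTau_mem_Icc (ω : Ω) : W.servingTau ω ∈ Icc (0 : ℝ) 1 := by
  unfold servingTau
  by_cases h : W.servingDist ω ∈ Ioi (0 : ℝ)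
  · rw [Set.indicator_of_mem h]
    exact ⟨p.condTau_nonneg W.eve_poisson _ h, p.condTau_le_one W.eve_poisson _ h⟩
  · rw [Set.indicator_of_notMem h]
    simp

/-- With stations and blockage fixed, integrating the fading gives an Erlang tail, and integrating
the eavesdroppers turns it into `condTau` at the serving type and distance. -/
theorem measure_one_le_ratio : P {ω | 1 ≤ p.sampleRatio (W.sample ω)}
    = ∫⁻ ω, ENNReal.ofReal (W.servingTau ω) ∂P := by
  have hE : MeasurableSet {x | 1 ≤ p.sampleRatio x} :=
    measurableSet_le measurable_const p.measurable_sampleRatio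
  have := Measure.isProbabilityMeasure_map (W.measurable_bs.aemeasurable (μ := P))
  have := p.isProbabilityMeasure_eveLaw W.eve_poisson
  have h1 : P {ω | 1 ≤ p.sampleRatio (W.sample ω)}
      = ∫⁻ ω, {x | 1 ≤ p.sampleRatio x}.indicator 1 (W.sample ω) ∂P := by
    rw [← lintegral_map' (measurable_one.indicator hE).aemeasurable W.aemeasurable_sample,
      lintegral_indicator_one hE, Measure.map_apply_of_aemeasurable W.aemeasurable_sample hE]
    rfl
  have h2 := W.lintegral_sample W.measurable_sampleTau.ennreal_ofReal
  rw [h1, W.lintegral_sample (measurable_one.indicator hE)]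
  refine Eq.trans ?_ h2.symm
  refine lintegral_congr_ae ?_
  filter_upwards [W.ae_map_bs_ne_zero] with b hb
  refine lintegral_congr fun v => ?_
  set i := p.servingIndex b v with hi
  have hr : 0 < ‖b i‖ := norm_pos_iff.2 (hb i)
  have h3 : ∫⁻ z, ∫⁻ g, {x | 1 ≤ p.sampleRatio x}.indicator 1
        ((b, z, fun k => (v k, g k)) : Sample) ∂p.fadingLaw ∂(p.eveLaw W.eve P)
      = ENNReal.ofReal (p.condTau (p.linkType (v i) ‖b i‖) ‖b i‖) := by
    rw [Params.condTau, ← (p.lintegral_erlangTail_aggregate W.eve_poisson i (b i)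
      (p.arg_pos (p.linkType (v i) ‖b i‖) hr) _).1]
    refine lintegral_congr_ae ?_
    filter_upwards [p.aggregate_lt_top W.eve_poisson i (b i)] with z hz
    exact p.lintegral_fading_ratio hb v hi.symm hz
  rw [h3]
  change _ = ∫⁻ _, ∫⁻ _, ENNReal.ofReal ((Ioi 0).indicator
    (p.condTau (p.linkType (v i) ‖b i‖)) ‖b i‖) ∂p.fadingLaw ∂(p.eveLaw W.eve P)
  rw [Set.indicator_of_mem (by exact hr)]
  simp

theorem tauC_eq_integral : W.tauC = ∫ ω, W.servingTau ω ∂P := by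
  rw [integral_eq_lintegral_of_nonneg_ae
    (Eventually.of_forall fun ω => (W.servingTau_mem_Icc ω).1)
    W.aemeasurable_servingTau.aestronglyMeasurable, ← W.measure_one_le_ratio]
  rfl

omit [IsProbabilityMeasure P] in
lemma aemeasurable_servingDist : AEMeasurable W.servingDist P := by
  have h (i : ℕ) : Measurable fun x : Sample => ‖x.1 i‖ := by fun_prop
  have h1 := measurable_comp_nat p.measurable_sampleIndex h
  have h2 := h1.comp_aemeasurable W.aemeasurable_sample
  exact h2

omit [IsProbabilityMeasure P] in
lemma nullMeasurableSet_servingType (j : LinkType) :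
    NullMeasurableSet {ω | W.servingType ω = j} P := by
  have h : Measurable fun x => if p.sampleType x = j then (1 : ℝ) else 0 :=
    p.measurable_comp_serving (H := fun _ k _ => if k = j then (1 : ℝ) else 0)
      fun _ _ => measurable_const
  have h2 : MeasurableSet {x | p.sampleType x = j} := by
    have := h (measurableSet_singleton 1)
    convert! this using 1
    ext x
    by_cases hx : p.sampleType x = j <;> simp [hx]
  exact W.aemeasurable_sample.nullMeasurableSet_preimage h2

lemma servingDist_pos : ∀ᵐ ω ∂P, 0 < W.servingDist ω := by
  filter_upwards [W.bs_poisson.ae_ne_zero] with ω hω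
  exact norm_pos_iff.2 (hω _)

lemma integrable_servingTau : Integrable W.servingTau P :=
  Integrable.mono' (integrable_const (1 : ℝ)) W.aemeasurable_servingTau.aestronglyMeasurable
    (Eventually.of_forall fun ω => by
      rw [Real.norm_of_nonneg (W.servingTau_mem_Icc ω).1]
      exact (W.servingTau_mem_Icc ω).2)

omit [IsProbabilityMeasure P] in
lemma tauTerm_eq (j : LinkType) (r : ℝ) : W.tauTerm j r = W.assocProb j * p.condTau j r := by
  rw [tauTerm, Params.condTau, Finset.mul_sum]
  refine Finset.sum_congr rfl fun m _ => ?_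
  rw [Real.Gamma_nat_eq_factorial]
  ring

lemma ae_distLaw_pos (j : LinkType) : ∀ᵐ r ∂(W.distLaw j), 0 < r := by
  rw [distLaw, ae_map_iff (W.aemeasurable_servingDist.mono_ac cond_absolutelyContinuous)
    measurableSet_Ioi]
  exact cond_absolutelyContinuous.ae_le W.servingDist_pos

lemma tauTerm_ae_eq (j : LinkType) : W.tauTerm j =ᵐ[W.distLaw j]
    fun r => W.assocProb j * (Ioi 0).indicator (p.condTau j) r := by
  filter_upwards [W.ae_distLaw_pos j] with r hr
  rw [Set.indicator_of_mem (by exact hr), W.tauTerm_eq]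

instance (j : LinkType) : IsFiniteMeasure (W.distLaw j) := by
  unfold distLaw; infer_instance

theorem integrable_tauTerm (j : LinkType) : Integrable (W.tauTerm j) (W.distLaw j) := by
  refine Integrable.congr (Integrable.const_mul ?_ _) (W.tauTerm_ae_eq j).symm
  refine Integrable.mono' (integrable_const (1 : ℝ))
    (p.measurable_indicator_condTau W.eve_poisson j).aestronglyMeasurable
    (Eventually.of_forall fun r => ?_)
  by_cases h : r ∈ Ioi (0 : ℝ)
  · rw [Set.indicator_of_mem h, Real.norm_of_nonneg (p.condTau_nonneg W.eve_poisson j h)]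
    exact p.condTau_le_one W.eve_poisson j h
  · simp [Set.indicator_of_notMem h]

/-- The factor `A_j` cancels the normalisation of the conditional law. If `A_j = 0`, both sides
vanish. -/
theorem integral_tauTerm (j : LinkType) :
    ∫ r, W.tauTerm j r ∂(W.distLaw j) = ∫ ω in {ω | W.servingType ω = j}, W.servingTau ω ∂P := by
  rw [integral_congr_ae (W.tauTerm_ae_eq j), integral_const_mul, distLaw,
    integral_map (W.aemeasurable_servingDist.mono_ac cond_absolutelyContinuous)
      (p.measurable_indicator_condTau W.eve_poisson j).aestronglyMeasurable,
    ProbabilityTheory.cond, integral_smul_measure, assocProb]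
  have h1 : ∫ ω in {ω | W.servingType ω = j}, (Ioi 0).indicator (p.condTau j) (W.servingDist ω) ∂P
      = ∫ ω in {ω | W.servingType ω = j}, W.servingTau ω ∂P := by
    refine setIntegral_congr_ae₀ (W.nullMeasurableSet_servingType j)
      (Eventually.of_forall fun ω hω => ?_)
    have hω : W.servingType ω = j := hω
    rw [servingTau, hω]
  rw [h1, ENNReal.toReal_inv, smul_eq_mul, ← mul_assoc, ← Measure.real]
  by_cases h0 : P.real {ω | W.servingType ω = j} = 0
  · rw [setIntegral_measure_zero _ ((measureReal_eq_zero_iff).1 h0), mul_zero]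
  · rw [mul_inv_cancel₀ h0, one_mul]

theorem tauC_eq_sum : W.tauC = ∑ j : LinkType, ∫ r, W.tauTerm j r ∂(W.distLaw j) := by
  simp_rw [W.integral_tauTerm]
  change _ = ∑ j ∈ {LinkType.los, LinkType.nlos}, _
  have hc : {ω | W.servingType ω = LinkType.nlos} = {ω | W.servingType ω = LinkType.los}ᶜ := by
    ext ω
    simp only [mem_ofPred_eq, mem_compl_iff]
    cases W.servingType ω <;> simp
  rw [Finset.sum_pair (by decide), hc,
    integral_add_compl₀ (W.nullMeasurableSet_servingType _) W.integrable_servingTau,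
    W.tauC_eq_integral]

end Network

end MmWave

theorem theorem3 {Ω : Type*} [MeasurableSpace Ω] (P : Measure Ω) [IsProbabilityMeasure P]
    (p : MmWave.Params) (W : MmWave.Network p P) :
    (∀ᵐ ω ∂P, W.IE ω < ∞) ∧
    (∀ s : ℝ, 0 < s → W.laplaceIE s = Real.exp (p.Xi s)) ∧
    ContDiffOn ℝ (⊤ : ℕ∞) p.expXi (Ioi 0) ∧
    (∀ j : MmWave.LinkType, Integrable (W.tauTerm j) (W.distLaw j)) ∧
    W.tauC = ∑ j : MmWave.LinkType, ∫ r, W.tauTerm j r ∂(W.distLaw j) := by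
  exact ⟨W.IE_lt_top, fun s hs => W.laplaceIE_eq hs, p.contDiffOn_expXi W.eve_poisson,
    W.integrable_tauTerm, W.tauC_eq_sum⟩
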